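/- Let $K$ be a field, $S=K[x_1,\dots,x_n]$ with the standard grading, and let $I\subseteq(x_1,\dots,x_n)$ be a graded ideal of codimension $s=\dim S-\dim S/I$ such that $S/I$ is Cohen–Macaulay. Let $$0\to\bigoplus_{j=1}^{b_p}S(-d_{pj})\to\cdots\to\bigoplus_{j=1}^{b_1}S(-d_{1j})\to S\to 0$$ be the minimal graded free resolution of $S/I$ (with $b_p\neq 0$), put $m_i=\min_j d_{ij}$ and $M_i=\max_j d_{ij}$ (so $M_0=0$), and suppose that the resolution is quasi-pure, i.e. $m_i\ge M_{i-1}$ for $1\le i\le p$. Then $p=s$, the multiplicity $e(S/I)$ satisfies $$\frac{1}{s!}\prod_{i=1}^s m_i\;\le\; e(S/I)\;\le\;\frac{1}{s!}\prod_{i=1}^s M_i,$$ and if either of these two inequalities is an equality, then the resolution is pure, i.e. for each $i$ the shift $d_{ij}$ does not depend on $j$. Here $e(S/I)=Q(1)$, where $\sum_{k\ge0}\dim_K(S/I)_k\,t^k=Q(t)/(1-t)^{d}$ with $d=\dim S/I$ and $Q\in\mathbb Z[t]$. -/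

import Mathlib

open MvPolynomial

noncomputable section

attribute [local instance] MvPolynomial.gradedAlgebra

/-- A graded ideal of `S = K[x₁, …, xₙ]` (standard grading) contained in `(x₁, …, xₙ)`. -/
def IsProperGradedIdeal {K : Type*} [Field K] {n : ℕ} (I : Ideal (MvPolynomial (Fin n) K)) : Prop :=
  I.IsHomogeneous (homogeneousSubmodule (Fin n) K) ∧ I ≤ idealOfVars (Fin n) K

/-- `I` has codimension `s`, i.e. `dim S - dim S/I = s`. -/
def HasCodimension {K : Type*} [Field K] {n : ℕ} (I : Ideal (MvPolynomial (Fin n) K))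
    (s : ℕ) : Prop :=
  ringKrullDim (MvPolynomial (Fin n) K ⧸ I) + (s : WithBot ℕ∞) =
    ringKrullDim (MvPolynomial (Fin n) K)

/-- The homogeneous `K`-algebra `R = S/I` is Cohen–Macaulay, i.e. `depth R = dim R`: its graded
maximal ideal contains an `R`-regular sequence of length `dim R`. -/
def IsCohenMacaulayIdeal {K : Type*} [Field K] {n : ℕ}
    (I : Ideal (MvPolynomial (Fin n) K)) : Prop :=
  ∃ rs : List (MvPolynomial (Fin n) K ⧸ I),
    RingTheory.Sequence.IsRegular (MvPolynomial (Fin n) K ⧸ I) rs ∧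
    (∀ r ∈ rs, r ∈ (idealOfVars (Fin n) K).map (Ideal.Quotient.mk I)) ∧
    (rs.length : WithBot ℕ∞) = ringKrullDim (MvPolynomial (Fin n) K ⧸ I)

/-- The Hilbert function `k ↦ dim_K (S/I)_k`; the degree `k` component of `S/I` is the image of
the degree `k` component of `S`. -/
def hilbertFunction {K : Type*} [Field K] {n : ℕ} (I : Ideal (MvPolynomial (Fin n) K))
    (k : ℕ) : ℕ :=
  Module.finrank K
    ((homogeneousSubmodule (Fin n) K k).map (Ideal.Quotient.mkₐ K I).toLinearMap)

/-- The Hilbert series `∑ₖ dim_K (S/I)_k tᵏ`. -/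
def hilbertSeries {K : Type*} [Field K] {n : ℕ} (I : Ideal (MvPolynomial (Fin n) K)) :
    PowerSeries ℤ :=
  PowerSeries.mk fun k => (hilbertFunction I k : ℤ)

/-- The Krull dimension of `S/I` as a natural number (it is finite, and nonnegative for `I ≠ S`). -/
def quotientDim {K : Type*} [Field K] {n : ℕ} (I : Ideal (MvPolynomial (Fin n) K)) : ℕ :=
  ((ringKrullDim (MvPolynomial (Fin n) K ⧸ I)).unbotD 0).toNat

/-- The multiplicity `e(S/I) = Q(1)`, where the Hilbert series of `S/I` is `Q(t) / (1 - t) ^ d`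
with `d = dim S/I` and `Q` a polynomial; `Q(1)` is the (finite) sum of the coefficients of
`Q(t) = (1 - t) ^ d * H(t)`. -/
def multiplicityQuot {K : Type*} [Field K] {n : ℕ} (I : Ideal (MvPolynomial (Fin n) K)) : ℤ :=
  ∑ᶠ k : ℕ, PowerSeries.coeff k ((1 - PowerSeries.X) ^ quotientDim I * hilbertSeries I)

/-- A minimal graded free resolution
`0 → ⨁ⱼ S(-d_{pj}) → ⋯ → ⨁ⱼ S(-d_{1j}) → S → 0` of `S/I`, where `p = length`,
`d_{ij} = shift i j`, the `i`-th module has rank `rank i`, and the map from step `i + 1` to step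
`i` is given by the matrix `diff i`. -/
structure MinimalGradedFreeResolution {K : Type*} [Field K] {n : ℕ}
    (I : Ideal (MvPolynomial (Fin n) K)) where
  length : ℕ
  rank : ℕ → ℕ
  shift : (i : ℕ) → Fin (rank i) → ℕ
  diff : (i : ℕ) → Matrix (Fin (rank i)) (Fin (rank (i + 1))) (MvPolynomial (Fin n) K)
  rank_length : rank length ≠ 0
  rank_of_length_lt : ∀ i, length < i → rank i = 0
  /-- The module at step `0` is `S`, without shift. -/
  rank_zero : rank 0 = 1
  shift_zero : ∀ j, shift 0 j = 0
  /-- The maps are homogeneous of degree `0`: the entry from `S(-d_{i+1,k})` to `S(-d_{ij})` is a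
  form of degree `d_{i+1,k} - d_{ij}`, and is zero if that number is negative. -/
  homogeneous : ∀ i j k, diff i j k = 0 ∨
    ∃ e : ℕ, shift (i + 1) k = shift i j + e ∧ (diff i j k).IsHomogeneous e
  /-- Minimality: the entries of the maps lie in `(x₁, …, xₙ)`. -/
  minimal : ∀ i j k, diff i j k ∈ idealOfVars (Fin n) K
  exact : ∀ i, Function.Exact (diff (i + 1)).mulVecLin (diff i).mulVecLin
  /-- The cokernel of the last map is `S/I`, i.e. the image of the last map in `S` is `I`. -/
  range_eq : ∀ f, (fun _ => f) ∈ LinearMap.range (diff 0).mulVecLin ↔ f ∈ I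

namespace MinimalGradedFreeResolution

/-- `mᵢ`, the smallest shift at step `i`. -/
def minShift {K : Type*} [Field K] {n : ℕ} {I : Ideal (MvPolynomial (Fin n) K)}
    (F : MinimalGradedFreeResolution I) (i : ℕ) : ℕ :=
  ⨅ j, F.shift i j

/-- `Mᵢ`, the largest shift at step `i`. -/
def maxShift {K : Type*} [Field K] {n : ℕ} {I : Ideal (MvPolynomial (Fin n) K)}
    (F : MinimalGradedFreeResolution I) (i : ℕ) : ℕ :=
  ⨆ j, F.shift i j

/-- At each step all shifts are equal. -/
def IsPure {K : Type*} [Field K] {n : ℕ} {I : Ideal (MvPolynomial (Fin n) K)}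
    (F : MinimalGradedFreeResolution I) : Prop :=
  ∀ i j k, F.shift i j = F.shift i k

/-- `mᵢ ≥ Mᵢ₋₁` for `1 ≤ i ≤ p`. -/
def IsQuasiPure {K : Type*} [Field K] {n : ℕ} {I : Ideal (MvPolynomial (Fin n) K)}
    (F : MinimalGradedFreeResolution I) : Prop :=
  ∀ i < F.length, F.maxShift i ≤ F.minShift (i + 1)

/-- `(∏_{i=1}^s mᵢ) / s!` -/
def lowerBound {K : Type*} [Field K] {n : ℕ} {I : Ideal (MvPolynomial (Fin n) K)}
    (F : MinimalGradedFreeResolution I) (s : ℕ) : ℚ :=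
  (∏ i ∈ Finset.Icc 1 s, (F.minShift i : ℚ)) / (s.factorial : ℚ)

/-- `(∏_{i=1}^s Mᵢ) / s!` -/
def upperBound {K : Type*} [Field K] {n : ℕ} {I : Ideal (MvPolynomial (Fin n) K)}
    (F : MinimalGradedFreeResolution I) (s : ℕ) : ℚ :=
  (∏ i ∈ Finset.Icc 1 s, (F.maxShift i : ℚ)) / (s.factorial : ℚ)

end MinimalGradedFreeResolution

end

/-! Put d = dim S/I. The resolution gives ∑ᵢ (-1)ⁱ ∑ⱼ t^dᵢⱼ = (1 - t)^s Q(t) with Q(1) = e(S/I).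
Apply the additive functional t^k ↦ g(k), where g(x) = ∏ₖ (mₖ - x) has degree s. Multiplication by 1
- t becomes minus the forward difference of g, so the right side turns into s!·e(S/I)
(`evalFunctional_prod`). The left side is g(0) = ∏ mₖ plus the terms (-1)ⁱ g(dᵢⱼ), i ≥ 1.
Quasi-purity puts dᵢⱼ above m₁, …, mᵢ and below the later mₖ, so these terms are nonnegative: this
is the lower bound. With Mₖ in place of mₖ only i - 1 roots are put below dᵢⱼ, the sign flips, and
the upper bound follows.

In case of equality every term vanishes, so each dᵢⱼ is one of the mₖ (or Mₖ). The columns of a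
minimal differential are nonzero, hence dᵢⱼ > mᵢ₋₁, and an upward induction settles the case of the
Mₖ. The mₖ require a downward induction and nonzero rows before the last step
(`exists_diff_succ_ne_zero`): a zero row at step i < s is incompatible with Ext^i(S/I, S) being
killed by an element outside (x₁, …, xₙ).

As for the length, if p < s then the product of only p factors is sent to 0 by the right side, while
the left side is at least ∏ mₖ > 0 (`codim_le_length`). Conversely Ext^(n-p)(K, S/I) ≠ 0, whereas
Cohen–Macaulayness kills Ext^i(K, S/I) for i < d, so p ≤ n - d = s (`length_add_le`). -/

open MvPolynomial

noncomputable section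

attribute [local instance] MvPolynomial.gradedAlgebra

/-! ### Finite differences and functionals on ℤ[t]. -/

open scoped Polynomial in
/-- The additive functional on `ℤ[t]` sending `t ^ k` to `g k`. -/
def evalFunctional (g : ℚ → ℚ) : ℤ[X] →+ ℚ where
  toFun P := P.sum fun k c => (c : ℚ) * g k
  map_zero' := by simp
  map_add' P Q := by
    apply Polynomial.sum_add_index <;> intros <;> simp [add_mul]

open scoped Polynomial in
theorem evalFunctional_monomial (g : ℚ → ℚ) (k : ℕ) (c : ℤ) :
    evalFunctional g (Polynomial.monomial k c) = c * g k := by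
  simp [evalFunctional, Polynomial.sum_monomial_index]

open scoped Polynomial in
theorem evalFunctional_X_pow (g : ℚ → ℚ) (k : ℕ) : evalFunctional g (Polynomial.X ^ k) = g k := by
  rw [← Polynomial.monomial_one_right_eq_X_pow, evalFunctional_monomial]; simp

open scoped Polynomial in
-- Summation by parts: `(1 - t) * t ^ k` is sent to `g k - g (k + 1)`.
theorem evalFunctional_one_sub_X_mul (g : ℚ → ℚ) (R : ℤ[X]) :
    evalFunctional g ((1 - Polynomial.X) * R) = -evalFunctional (fwdDiff 1 g) R := by
  induction R using Polynomial.induction_on' with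
  | add p q hp hq => rw [mul_add, map_add, map_add, hp, hq]; ring
  | monomial k c =>
    rw [sub_mul, one_mul, Polynomial.X_mul_monomial, map_sub]
    simp only [evalFunctional_monomial, fwdDiff]
    push_cast; ring

open scoped Polynomial in
theorem evalFunctional_one_sub_X_pow_mul (s : ℕ) (g : ℚ → ℚ) (R : ℤ[X]) :
    evalFunctional g ((1 - Polynomial.X) ^ s * R) =
      (-1) ^ s * evalFunctional ((fwdDiff 1)^[s] g) R := by
  induction s generalizing g with
  | zero => simp
  | succ s ih =>
    rw [pow_succ', mul_assoc, evalFunctional_one_sub_X_mul, ih, Function.iterate_succ_apply]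
    ring

open scoped Polynomial in
theorem evalFunctional_const (c : ℚ) (R : ℤ[X]) :
    evalFunctional (fun _ => c) R = (R.eval 1 : ℤ) * c := by
  induction R using Polynomial.induction_on' with
  | add p q hp hq => rw [map_add, hp, hq]; simp [add_mul]
  | monomial k a => simp [evalFunctional_monomial]

open scoped Polynomial in
-- The `s`-th difference annihilates polynomials of degree `t < s`. This is what excludes
-- resolutions shorter than the codimension.
theorem evalFunctional_prod_of_lt {t s : ℕ} (h : t < s) (a : ℕ → ℚ) (R : ℤ[X]) :
    evalFunctional (fun x => ∏ k ∈ Finset.range t, (a k - x)) ((1 - Polynomial.X) ^ s * R) = 0 := by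
  have e : (fun x => ∏ k ∈ Finset.range t, (a k - x)) =
      (∏ k ∈ Finset.range t, (Polynomial.C (a k) - Polynomial.X)).eval := by
    ext x; simp [Polynomial.eval_prod]
  have hd : (∏ k ∈ Finset.range t, (Polynomial.C (a k) - Polynomial.X)).natDegree < s := by
    refine lt_of_le_of_lt (Polynomial.natDegree_prod_le _ _) (lt_of_le_of_lt ?_ h)
    refine (Finset.sum_le_card_nsmul _ _ 1 fun k _ => ?_).trans (by simp)
    rw [← neg_sub, Polynomial.natDegree_neg, Polynomial.natDegree_X_sub_C]
  rw [evalFunctional_one_sub_X_pow_mul, e, Polynomial.fwdDiff_iter_eq_zero_of_degree_lt hd]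
  have := evalFunctional_const 0 R
  rw [mul_zero] at this
  rw [show (0 : ℚ → ℚ) = fun _ => 0 from rfl, this, mul_zero]

open scoped Polynomial in
-- The `s`-th difference of a polynomial of degree `s` is `s!` times its leading coefficient. That
-- coefficient is `(-1) ^ s`, which cancels the sign from moving `(1 - t) ^ s` onto the function.
theorem evalFunctional_prod (s : ℕ) (a : ℕ → ℚ) (R : ℤ[X]) :
    evalFunctional (fun x => ∏ k ∈ Finset.range s, (a k - x)) ((1 - Polynomial.X) ^ s * R) =
      s.factorial * (R.eval 1 : ℤ) := by
  set f : ℚ[X] := ∏ k ∈ Finset.range s, (Polynomial.X - Polynomial.C (a k)) with hf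
  have e : (fun x => ∏ k ∈ Finset.range s, (a k - x)) = (-1 : ℚ) ^ s • f.eval := by
    ext x
    simp only [hf, Pi.smul_apply, Polynomial.eval_prod, Polynomial.eval_sub, Polynomial.eval_X,
      Polynomial.eval_C, smul_eq_mul]
    rw [← Finset.card_range s, ← Finset.prod_const, Finset.card_range, ← Finset.prod_mul_distrib]
    exact Finset.prod_congr rfl fun k _ => by ring
  have hm : f.Monic := Polynomial.monic_prod_of_monic _ _ fun k _ => Polynomial.monic_X_sub_C _
  have hd : f.natDegree = s := by
    rw [hf, Polynomial.natDegree_prod_of_monic _ _ fun k _ => Polynomial.monic_X_sub_C _]; simp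
  have hΔ : (fwdDiff (1 : ℚ))^[s] f.eval = fun _ => (s.factorial : ℚ) := by
    have := Polynomial.fwdDiff_iter_degree_eq_factorial f
    rw [hd, hm.leadingCoeff] at this
    rw [this]; ext; simp
  rw [evalFunctional_one_sub_X_pow_mul, e, fwdDiff_iter_const_smul, hΔ]
  have : (-1 : ℚ) ^ s • (fun _ : ℚ => (s.factorial : ℚ)) = fun _ => (-1) ^ s * (s.factorial : ℚ) := by
    ext; simp
  rw [this, evalFunctional_const]
  have h1 : (-1 : ℚ) ^ s * (-1) ^ s = 1 := by rw [← mul_pow]; simp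
  linear_combination ((R.eval 1 : ℤ) * (s.factorial : ℚ)) * h1

/-- If the first `i` of the numbers `a 0, …, a (s - 1)` lie weakly below `x` and the others
weakly above, the product of the differences `a k - x` has the sign `(-1) ^ i` or vanishes. -/
theorem neg_one_pow_mul_prod_sub_nonneg {s i : ℕ} (hi : i ≤ s) (a : ℕ → ℚ) (x : ℚ)
    (h₁ : ∀ k < i, a k ≤ x) (h₂ : ∀ k, i ≤ k → k < s → x ≤ a k) :
    0 ≤ (-1) ^ i * ∏ k ∈ Finset.range s, (a k - x) := by
  rw [← Finset.prod_range_mul_prod_Ico _ hi, ← mul_assoc]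
  refine mul_nonneg ?_ (Finset.prod_nonneg fun k hk => ?_)
  · have : (-1 : ℚ) ^ i * ∏ k ∈ Finset.range i, (a k - x) = ∏ k ∈ Finset.range i, (x - a k) := by
      nth_rw 1 [← Finset.card_range i]
      rw [← Finset.prod_const, ← Finset.prod_mul_distrib]
      exact Finset.prod_congr rfl fun k _ => by ring
    rw [this]
    exact Finset.prod_nonneg fun k hk => sub_nonneg.2 (h₁ k (Finset.mem_range.1 hk))
  · rw [Finset.mem_Ico] at hk
    exact sub_nonneg.2 (h₂ k hk.1 hk.2)

/-! ### Hilbert functions of graded ideals. -/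

theorem Submodule.finrank_map_add_finrank_inf_ker {K V W : Type*} [Field K] [AddCommGroup V]
    [Module K V] [AddCommGroup W] [Module K W] (f : V →ₗ[K] W) (p : Submodule K V)
    [FiniteDimensional K p] :
    Module.finrank K (p.map f) + Module.finrank K (p ⊓ LinearMap.ker f : Submodule K V) =
      Module.finrank K p := by
  rw [← LinearMap.finrank_range_add_finrank_ker (f.domRestrict p), LinearMap.range_domRestrict,
    LinearMap.ker_domRestrict]
  congr 1
  rw [← LinearMap.finrank_range_of_inj
    (f := p.subtype.comp (LinearMap.ker f |>.comap p.subtype).subtype) ?_]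
  · rw [LinearMap.range_comp, Submodule.range_subtype, Submodule.map_comap_subtype]
  · exact p.injective_subtype.comp (Submodule.injective_subtype _)

section Graded

variable {K : Type*} [Field K] {n : ℕ}

instance finiteDimensional_homogeneousSubmodule (k : ℕ) :
    FiniteDimensional K (homogeneousSubmodule (Fin n) K k) :=
  Module.Finite.iff_fg.2 (homogeneousSubmodule_fg (Fin n) K k)

theorem homogeneousComponent_eq_decompose (f : MvPolynomial (Fin n) K) (i : ℕ) :
    homogeneousComponent i f =
      (DirectSum.decompose (homogeneousSubmodule (Fin n) K) f i : MvPolynomial (Fin n) K) :=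
  (decomposition.decompose'_apply f i).symm

theorem MvPolynomial.IsHomogeneous.homogeneousComponent_mul {a : MvPolynomial (Fin n) K} {e : ℕ}
    (ha : a.IsHomogeneous e) (c : MvPolynomial (Fin n) K) (k : ℕ) :
    homogeneousComponent k (a * c) = if e ≤ k then a * homogeneousComponent (k - e) c else 0 := by
  rw [homogeneousComponent_eq_decompose, homogeneousComponent_eq_decompose]
  exact DirectSum.coe_decompose_mul_of_left_mem (homogeneousSubmodule (Fin n) K) k ha

theorem isHomogeneous_colon {I : Ideal (MvPolynomial (Fin n) K)}
    (hI : I.IsHomogeneous (homogeneousSubmodule (Fin n) K)) {a : MvPolynomial (Fin n) K} {e : ℕ}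
    (ha : a.IsHomogeneous e) : (I.colon {a}).IsHomogeneous (homogeneousSubmodule (Fin n) K) := by
  intro k r hr
  rw [Submodule.mem_colon_singleton, smul_eq_mul, mul_comm] at hr ⊢
  have := homogeneousComponent_mem_of_mem hI hr (e + k)
  rw [ha.homogeneousComponent_mul, if_pos (Nat.le_add_right _ _), Nat.add_sub_cancel_left,
    homogeneousComponent_eq_decompose] at this
  exact this

theorem isHomogeneous_sup_span {I : Ideal (MvPolynomial (Fin n) K)}
    (hI : I.IsHomogeneous (homogeneousSubmodule (Fin n) K)) {a : MvPolynomial (Fin n) K} {e : ℕ}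
    (ha : a.IsHomogeneous e) :
    (I ⊔ Ideal.span {a}).IsHomogeneous (homogeneousSubmodule (Fin n) K) :=
  hI.sup (Ideal.homogeneous_span _ _ fun x hx => ⟨e, by rw [Set.mem_singleton_iff.1 hx]; exact ha⟩)

/-- The degree `k` component of an ideal. -/
def gradedPiece (I : Ideal (MvPolynomial (Fin n) K)) (k : ℕ) :
    Submodule K (MvPolynomial (Fin n) K) :=
  homogeneousSubmodule (Fin n) K k ⊓ I.restrictScalars K

theorem mem_gradedPiece {I : Ideal (MvPolynomial (Fin n) K)} {k : ℕ} {f : MvPolynomial (Fin n) K} :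
    f ∈ gradedPiece I k ↔ f.IsHomogeneous k ∧ f ∈ I := Iff.rfl

instance (I : Ideal (MvPolynomial (Fin n) K)) (k : ℕ) : FiniteDimensional K (gradedPiece I k) :=
  Submodule.finiteDimensional_inf_left _ _

/-- Replaces dimensions of quotients by dimensions of subspaces of `S_k`, where the comparisons
below take place. -/
theorem hilbertFunction_add_finrank (I : Ideal (MvPolynomial (Fin n) K)) (k : ℕ) :
    hilbertFunction I k + Module.finrank K (gradedPiece I k) =
      Module.finrank K (homogeneousSubmodule (Fin n) K k) := by
  have : gradedPiece I k = homogeneousSubmodule (Fin n) K k ⊓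
      LinearMap.ker (Ideal.Quotient.mkₐ K I).toLinearMap := by
    ext f
    simp [gradedPiece, Ideal.Quotient.eq_zero_iff_mem]
  rw [this]
  exact Submodule.finrank_map_add_finrank_inf_ker _ _

theorem gradedPiece_sup_span_of_lt {I : Ideal (MvPolynomial (Fin n) K)}
    (hI : I.IsHomogeneous (homogeneousSubmodule (Fin n) K)) {a : MvPolynomial (Fin n) K} {e : ℕ}
    (ha : a.IsHomogeneous e) {k : ℕ} (hk : k < e) :
    gradedPiece (I ⊔ Ideal.span {a}) k = gradedPiece I k := by
  ext f
  rw [mem_gradedPiece, mem_gradedPiece]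
  refine ⟨fun ⟨hf, hf'⟩ => ⟨hf, ?_⟩, fun ⟨hf, hf'⟩ => ⟨hf, Ideal.mem_sup_left hf'⟩⟩
  obtain ⟨g, h, hh, e'⟩ := Ideal.mem_span_singleton_sup.1 (sup_comm I _ ▸ hf')
  rw [← homogeneousComponent_eq_self hf, ← e', map_add, mul_comm, ha.homogeneousComponent_mul,
    if_neg (by omega), zero_add]
  exact homogeneousComponent_mem_of_mem hI hh _

theorem gradedPiece_sup_span_add {I : Ideal (MvPolynomial (Fin n) K)}
    (hI : I.IsHomogeneous (homogeneousSubmodule (Fin n) K)) {a : MvPolynomial (Fin n) K} {e : ℕ}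
    (ha : a.IsHomogeneous e) (k : ℕ) :
    gradedPiece (I ⊔ Ideal.span {a}) (k + e) =
      gradedPiece I (k + e) ⊔ (homogeneousSubmodule (Fin n) K k).map (LinearMap.mulLeft K a) := by
  apply le_antisymm
  · rintro f ⟨hf, hf'⟩
    obtain ⟨g, h, hh, e'⟩ := Ideal.mem_span_singleton_sup.1 (sup_comm I _ ▸ hf')
    rw [← homogeneousComponent_eq_self hf, ← e', map_add, mul_comm, ha.homogeneousComponent_mul,
      if_pos (Nat.le_add_left _ _), Nat.add_sub_cancel, add_comm (a * _)]
    exact Submodule.add_mem_sup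
      ⟨homogeneousComponent_isHomogeneous _ _, homogeneousComponent_mem_of_mem hI hh _⟩
      (Submodule.mem_map_of_mem (f := LinearMap.mulLeft K a) (homogeneousComponent_mem _ _))
  · refine sup_le (fun f hf => ⟨hf.1, Ideal.mem_sup_left hf.2⟩) ?_
    rintro _ ⟨f, hf, rfl⟩
    refine ⟨?_, Ideal.mem_sup_right (Ideal.mem_span_singleton.2 ⟨f, rfl⟩)⟩
    rw [add_comm]
    exact ha.mul hf

theorem hilbertFunction_of_lt {I : Ideal (MvPolynomial (Fin n) K)}
    (hI : I.IsHomogeneous (homogeneousSubmodule (Fin n) K)) {a : MvPolynomial (Fin n) K} {e : ℕ}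
    (ha : a.IsHomogeneous e) {k : ℕ} (hk : k < e) :
    hilbertFunction I k = hilbertFunction (I ⊔ Ideal.span {a}) k := by
  have h₁ := hilbertFunction_add_finrank I k
  have h₂ := hilbertFunction_add_finrank (I ⊔ Ideal.span {a}) k
  rw [gradedPiece_sup_span_of_lt hI ha hk] at h₂
  omega

/-- The space `(I + (a))_{k+e}` is the sum of `I_{k+e}` and `a S_k`, whose intersection is `a (I :
a)_k`; multiplication by `a` preserves dimensions. -/
theorem hilbertFunction_add_degree {I : Ideal (MvPolynomial (Fin n) K)}
    (hI : I.IsHomogeneous (homogeneousSubmodule (Fin n) K)) {a : MvPolynomial (Fin n) K} {e : ℕ}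
    (ha : a.IsHomogeneous e) (ha0 : a ≠ 0) (k : ℕ) :
    hilbertFunction I (k + e) =
      hilbertFunction (I ⊔ Ideal.span {a}) (k + e) + hilbertFunction (I.colon {a}) k := by
  have hinj : Function.Injective (LinearMap.mulLeft K a) := fun x y h => mul_left_cancel₀ ha0 h
  have h₁ := hilbertFunction_add_finrank I (k + e)
  have h₂ := hilbertFunction_add_finrank (I ⊔ Ideal.span {a}) (k + e)
  have h₃ := hilbertFunction_add_finrank (I.colon {a}) k
  have h₄ := Submodule.finrank_sup_add_finrank_inf_eq (gradedPiece I (k + e))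
    ((homogeneousSubmodule (Fin n) K k).map (LinearMap.mulLeft K a))
  rw [← gradedPiece_sup_span_add hI ha k,
    (Submodule.equivMapOfInjective _ hinj _).finrank_eq.symm] at h₄
  have h₅ : gradedPiece I (k + e) ⊓ (homogeneousSubmodule (Fin n) K k).map (LinearMap.mulLeft K a) =
      (gradedPiece (I.colon {a}) k).map (LinearMap.mulLeft K a) := by
    ext f
    constructor
    · rintro ⟨hf, g, hg, rfl⟩
      refine ⟨g, ⟨hg, ?_⟩, rfl⟩
      rw [Submodule.coe_restrictScalars, SetLike.mem_coe, Submodule.mem_colon_singleton,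
        smul_eq_mul, mul_comm]
      exact hf.2
    · rintro ⟨g, ⟨hg, hg'⟩, rfl⟩
      rw [Submodule.coe_restrictScalars, SetLike.mem_coe, Submodule.mem_colon_singleton,
        smul_eq_mul, mul_comm] at hg'
      exact ⟨⟨by rw [add_comm]; exact ha.mul hg, hg'⟩, g, hg, rfl⟩
  rw [h₅, (Submodule.equivMapOfInjective _ hinj _).finrank_eq.symm] at h₄
  omega

/-- Additivity of the Hilbert series along
`0 → S/(I : a)(-e) → S/I → S/(I + (a)) → 0`. -/
theorem hilbertSeries_eq_add {I : Ideal (MvPolynomial (Fin n) K)}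
    (hI : I.IsHomogeneous (homogeneousSubmodule (Fin n) K)) {a : MvPolynomial (Fin n) K} {e : ℕ}
    (ha : a.IsHomogeneous e) (ha0 : a ≠ 0) :
    hilbertSeries I = hilbertSeries (I ⊔ Ideal.span {a}) +
      PowerSeries.X ^ e * hilbertSeries (I.colon {a}) := by
  ext k
  rw [map_add, PowerSeries.coeff_X_pow_mul']
  simp only [hilbertSeries, PowerSeries.coeff_mk]
  split_ifs with h
  · obtain ⟨k, rfl⟩ := Nat.exists_eq_add_of_le' h
    rw [Nat.add_sub_cancel, hilbertFunction_add_degree hI ha ha0]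
    push_cast; rfl
  · rw [hilbertFunction_of_lt hI ha (by omega), add_zero]

theorem one_sub_X_mul_hilbertSeries {I : Ideal (MvPolynomial (Fin n) K)}
    (hI : I.IsHomogeneous (homogeneousSubmodule (Fin n) K)) (i : Fin n)
    (h : ∀ f, X i * f ∈ I → f ∈ I) :
    (1 - PowerSeries.X) * hilbertSeries I = hilbertSeries (I ⊔ Ideal.span {X i}) := by
  have hc : I.colon {X i} = I := by
    ext f
    rw [Submodule.mem_colon_singleton, smul_eq_mul, mul_comm]
    exact ⟨h f, fun hf => I.mul_mem_left _ hf⟩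
  have := hilbertSeries_eq_add hI (isHomogeneous_X K i) (X_ne_zero i)
  rw [hc] at this
  linear_combination this

theorem hilbertSeries_top : hilbertSeries (⊤ : Ideal (MvPolynomial (Fin n) K)) = 0 := by
  ext k
  have := hilbertFunction_add_finrank (⊤ : Ideal (MvPolynomial (Fin n) K)) k
  have h : gradedPiece (⊤ : Ideal (MvPolynomial (Fin n) K)) k = homogeneousSubmodule (Fin n) K k := by
    ext f; simp [mem_gradedPiece]
  rw [h] at this
  simp only [hilbertSeries, PowerSeries.coeff_mk, map_zero]
  omega

theorem mem_idealOfVars_iff {f : MvPolynomial (Fin n) K} :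
    f ∈ idealOfVars (Fin n) K ↔ coeff 0 f = 0 := by
  have := mem_pow_idealOfVars_iff' 1 f
  rw [pow_one] at this
  rw [this]
  constructor
  · exact fun h => h 0 (by simp)
  · intro h x hx
    rw [(Finsupp.degree_eq_zero_iff x).1 (by omega)]
    exact h

theorem hilbertSeries_idealOfVars : hilbertSeries (idealOfVars (Fin n) K) = 1 := by
  ext k
  simp only [hilbertSeries, PowerSeries.coeff_mk, PowerSeries.coeff_one]
  have := hilbertFunction_add_finrank (idealOfVars (Fin n) K) k
  split_ifs with hk
  · subst hk
    have h0 : gradedPiece (idealOfVars (Fin n) K) 0 = ⊥ := by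
      rw [eq_bot_iff]
      rintro f ⟨hf, hf'⟩
      rw [Submodule.mem_bot, ← homogeneousComponent_eq_self hf, homogeneousComponent_zero,
        mem_idealOfVars_iff.1 hf', C_0]
    have h1 : homogeneousSubmodule (Fin n) K 0 = Submodule.span K {1} := by
      ext f
      rw [Submodule.mem_span_singleton]
      constructor
      · intro hf
        refine ⟨coeff 0 f, ?_⟩
        rw [← C_mul', mul_one, ← homogeneousComponent_zero]
        exact homogeneousComponent_eq_self hf
      · rintro ⟨c, rfl⟩
        rw [← C_mul', mul_one]
        exact isHomogeneous_C _ _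
    rw [h0, finrank_bot, h1, finrank_span_singleton one_ne_zero] at this
    omega
  · have h : gradedPiece (idealOfVars (Fin n) K) k = homogeneousSubmodule (Fin n) K k := by
      ext f
      refine ⟨fun h => h.1, fun h => ⟨h, mem_idealOfVars_iff.2 ?_⟩⟩
      refine IsHomogeneous.coeff_eq_zero h ?_
      rw [map_zero]
      omega
    rw [h] at this
    omega

/-- Whether a monomial is divisible by some `x_j` with `j ≠ i` is unaffected by a factor `x_i`.
Serves both the Hilbert series of `S` and the regularity of the sequence of variables. -/
theorem X_mul_mem_span_X_image {s : Set (Fin n)} {i : Fin n} (hi : i ∉ s)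
    {f : MvPolynomial (Fin n) K}
    (h : X i * f ∈ Ideal.span (X '' s : Set (MvPolynomial (Fin n) K))) :
    f ∈ Ideal.span (X '' s : Set (MvPolynomial (Fin n) K)) := by
  rw [mem_ideal_span_X_image] at h ⊢
  intro m hm
  obtain ⟨j, hj, hj'⟩ := h (Finsupp.single i 1 + m) (by
    rw [mem_support_iff, coeff_X_mul]
    exact mem_support_iff.1 hm)
  refine ⟨j, hj, ?_⟩
  rwa [Finsupp.add_apply, Finsupp.single_eq_of_ne (fun e => hi (by rwa [← e])), zero_add] at hj'

theorem isHomogeneous_span_X_image (s : Set (Fin n)) :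
    (Ideal.span (X '' s : Set (MvPolynomial (Fin n) K))).IsHomogeneous
      (homogeneousSubmodule (Fin n) K) := by
  refine Ideal.homogeneous_span _ _ ?_
  rintro _ ⟨i, _, rfl⟩
  exact ⟨1, isHomogeneous_X K i⟩

/-- The Hilbert series of the polynomial ring is `1 / (1 - t) ^ n`. -/
theorem one_sub_X_pow_mul_hilbertSeries_bot :
    (1 - PowerSeries.X) ^ n * hilbertSeries (⊥ : Ideal (MvPolynomial (Fin n) K)) = 1 := by
  -- Each variable is a nonzerodivisor modulo those already killed and accounts for one factor `1 -
  -- t`. After all of them only `K` is left, with Hilbert series `1`.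
  have key : ∀ s : Finset (Fin n), (1 - PowerSeries.X) ^ s.card *
      hilbertSeries (⊥ : Ideal (MvPolynomial (Fin n) K)) =
        hilbertSeries (Ideal.span (X '' (s : Set (Fin n)) : Set (MvPolynomial (Fin n) K))) := by
    intro s
    induction s using Finset.induction_on with
    | empty => simp
    | insert i s hi ih =>
      rw [Finset.card_insert_of_notMem hi, pow_succ', mul_assoc, ih,
        one_sub_X_mul_hilbertSeries (isHomogeneous_span_X_image _) i
          fun f hf => X_mul_mem_span_X_image (by simpa using hi) hf,
        Finset.coe_insert, Set.image_insert_eq, Ideal.span_insert, sup_comm]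
  have := key Finset.univ
  rwa [Finset.card_univ, Fintype.card_fin, Finset.coe_univ, Set.image_univ,
    hilbertSeries_idealOfVars] at this

/-! ### Induction over homogeneous ideals; the pole of the Hilbert series. -/

theorem isMaximal_idealOfVars : (idealOfVars (Fin n) K).IsMaximal := by
  have : idealOfVars (Fin n) K = RingHom.ker (constantCoeff (R := K) (σ := Fin n)) := by
    ext f
    rw [mem_idealOfVars_iff, RingHom.mem_ker, constantCoeff_eq]
  rw [this]
  exact RingHom.ker_isMaximal_of_surjective _ fun c => ⟨C c, constantCoeff_C _ c⟩

/-- Noetherian induction on homogeneous ideals along the sequences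
`0 → S/(I : a) → S/I → S/(I + (a)) → 0`. -/
theorem homogeneousIdeal_induction {C : Ideal (MvPolynomial (Fin n) K) → Prop}
    (top : C ⊤) (vars : C (idealOfVars (Fin n) K))
    (prime : ∀ I : Ideal (MvPolynomial (Fin n) K),
      I.IsHomogeneous (homogeneousSubmodule (Fin n) K) → I.IsPrime → ∀ i, X i ∉ I →
        C (I ⊔ Ideal.span {X i}) → C I)
    (colon : ∀ I : Ideal (MvPolynomial (Fin n) K),
      I.IsHomogeneous (homogeneousSubmodule (Fin n) K) → ∀ e a, a.IsHomogeneous e → a ∉ I →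
        C (I ⊔ Ideal.span {a}) → C (I.colon {a}) → C I)
    (I : Ideal (MvPolynomial (Fin n) K)) (hI : I.IsHomogeneous (homogeneousSubmodule (Fin n) K)) :
    C I := by
  induction I using WellFoundedGT.induction with
  | ind I ih =>
  have hlt : ∀ {a}, a ∉ I → I < I ⊔ Ideal.span {a} := fun {a} ha =>
    left_lt_sup.2 fun h => ha ((Ideal.span_singleton_le_iff_mem _).1 h)
  by_cases htop : I = ⊤
  · rwa [htop]
  by_cases hp : I.IsPrime
  · by_cases hv : ∃ i, X i ∉ I
    · obtain ⟨i, hi⟩ := hv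
      exact prime I hI hp i hi (ih _ (hlt hi) (isHomogeneous_sup_span hI (isHomogeneous_X K i)))
    · push Not at hv
      rwa [← isMaximal_idealOfVars.eq_of_le htop (Ideal.span_le.2 (Set.range_subset_iff.2 hv))]
  -- Primality of a homogeneous ideal can be tested on homogeneous elements. If `a * b ∈ I` with `a,
  -- b ∉ I`, both `I + (a)` and `I : a`, which contains `b`, are strictly larger than `I`.
  · have : ∃ x y, SetLike.IsHomogeneousElem (homogeneousSubmodule (Fin n) K) x ∧
        SetLike.IsHomogeneousElem (homogeneousSubmodule (Fin n) K) y ∧ x * y ∈ I ∧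
        x ∉ I ∧ y ∉ I := by
      by_contra! h
      refine hp (hI.isPrime_of_homogeneous_mem_or_mem htop fun {x y} hx hy hxy => ?_)
      exact or_iff_not_imp_left.2 (h x y hx hy hxy)
    obtain ⟨a, b, ⟨e, ha⟩, -, hab, ha', hb'⟩ := this
    refine colon I hI e a ha ha' (ih _ (hlt ha') (isHomogeneous_sup_span hI ha))
      (ih _ (lt_of_le_of_ne (fun f hf => ?_) fun h => hb' ?_) (isHomogeneous_colon hI ha))
    · exact Submodule.mem_colon_singleton.2 (I.mul_mem_right _ hf)
    · rw [h, Submodule.mem_colon_singleton, smul_eq_mul, mul_comm]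
      exact hab

theorem ringKrullDim_quotient_le_of_le {R : Type*} [CommRing R] {I J : Ideal R} (h : I ≤ J) :
    ringKrullDim (R ⧸ J) ≤ ringKrullDim (R ⧸ I) :=
  ringKrullDim_le_of_surjective (Ideal.Quotient.factor h) (Ideal.Quotient.factor_surjective h)

theorem ringKrullDim_quotient_sup_span_succ_le {R : Type*} [CommRing R] {P : Ideal R} [P.IsPrime]
    {x : R} (hx : x ∉ P) : ringKrullDim (R ⧸ P ⊔ Ideal.span {x}) + 1 ≤ ringKrullDim (R ⧸ P) := by
  refine ringKrullDim_succ_le_of_surjective (Ideal.Quotient.factor le_sup_left)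
    (Ideal.Quotient.factor_surjective _) (r := Ideal.Quotient.mk P x) ?_ ?_
  · rw [mem_nonZeroDivisors_iff_ne_zero, ne_eq, Ideal.Quotient.eq_zero_iff_mem]
    exact hx
  · rw [Ideal.Quotient.factor_mk, Ideal.Quotient.eq_zero_iff_mem]
    exact Ideal.mem_sup_right (Ideal.mem_span_singleton_self x)

theorem le_colon_singleton {R : Type*} [CommRing R] (I : Ideal R) (a : R) : I ≤ I.colon {a} :=
  fun _ hf => Submodule.mem_colon_singleton.2 (I.mul_mem_right _ hf)

open scoped Polynomial in
/-- The pole of the Hilbert series at `t = 1` has order at most the Krull dimension. -/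
theorem exists_polynomial_hilbertSeries {I : Ideal (MvPolynomial (Fin n) K)}
    (hI : I.IsHomogeneous (homogeneousSubmodule (Fin n) K)) (d : ℕ)
    (hd : ringKrullDim (MvPolynomial (Fin n) K ⧸ I) ≤ d) :
    ∃ Q : ℤ[X], (1 - PowerSeries.X) ^ d * hilbertSeries I = (Q : PowerSeries ℤ) := by
  revert d
  refine homogeneousIdeal_induction (C := fun I => ∀ d : ℕ,
    ringKrullDim (MvPolynomial (Fin n) K ⧸ I) ≤ d → ∃ Q : ℤ[X],
      (1 - PowerSeries.X) ^ d * hilbertSeries I = (Q : PowerSeries ℤ)) ?_ ?_ ?_ ?_ I hI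
  · exact fun d _ => ⟨0, by simp [hilbertSeries_top]⟩
  · exact fun d _ => ⟨(1 - Polynomial.X) ^ d, by simp [hilbertSeries_idealOfVars]⟩
  · intro I hI hP i hi ih d hd
    have hle := (ringKrullDim_quotient_sup_span_succ_le hi).trans hd
    have hH := one_sub_X_mul_hilbertSeries hI i fun f hf => (hP.mem_or_mem hf).resolve_left hi
    cases d with
    | zero =>
      -- The dimension has to drop below `0`, so the smaller quotient is zero and `(1 - t) * H = 0`.
      have hbot : I ⊔ Ideal.span {X i} = ⊤ := by
        by_contra hne
        have := Ideal.Quotient.nontrivial_iff.2 hne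
        have h0 := ringKrullDim_nonneg_of_nontrivial
          (R := MvPolynomial (Fin n) K ⧸ I ⊔ Ideal.span {X i})
        have := (add_le_add_left h0 1).trans hle
        norm_num at this
      rw [hbot, hilbertSeries_top] at hH
      have : (1 - PowerSeries.X : PowerSeries ℤ) ≠ 0 := fun h => by
        simpa using congrArg PowerSeries.constantCoeff h
      exact ⟨0, by simp [(mul_eq_zero.1 hH).resolve_left this]⟩
    | succ d =>
      obtain ⟨Q, hQ⟩ := ih d (by
        push_cast at hle
        exact (ENat.WithBot.add_le_add_one_right_iff).1 hle)
      exact ⟨Q, by rw [pow_succ, mul_assoc, hH, hQ]⟩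
  · intro I hI e a ha ha' ih₁ ih₂ d hd
    obtain ⟨Q₁, h₁⟩ := ih₁ d ((ringKrullDim_quotient_le_of_le le_sup_left).trans hd)
    obtain ⟨Q₂, h₂⟩ := ih₂ d ((ringKrullDim_quotient_le_of_le (le_colon_singleton I a)).trans hd)
    refine ⟨Q₁ + Polynomial.X ^ e * Q₂, ?_⟩
    rw [hilbertSeries_eq_add hI ha (fun h => ha' (h ▸ I.zero_mem)), mul_add, h₁, mul_left_comm, h₂]
    simp

end Graded

/-! ### Graded free modules. -/

section GradedFree

variable {K : Type*} [Field K] {n : ℕ}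

/-- The degree `k` component of `S(-d)`. -/
def shiftedPiece (K : Type*) [Field K] (n d k : ℕ) : Submodule K (MvPolynomial (Fin n) K) :=
  if d ≤ k then homogeneousSubmodule (Fin n) K (k - d) else ⊥

/-- The projection of `S(-d)` onto its degree `k` component. -/
def shiftedComponent (d k : ℕ) (f : MvPolynomial (Fin n) K) : MvPolynomial (Fin n) K :=
  if d ≤ k then homogeneousComponent (k - d) f else 0

theorem shiftedComponent_mem (d k : ℕ) (f : MvPolynomial (Fin n) K) :
    shiftedComponent d k f ∈ shiftedPiece K n d k := by
  unfold shiftedComponent shiftedPiece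
  split_ifs
  · exact homogeneousComponent_mem _ _
  · exact Submodule.zero_mem _

theorem shiftedComponent_eq_self {d k : ℕ} {f : MvPolynomial (Fin n) K}
    (hf : f ∈ shiftedPiece K n d k) : shiftedComponent d k f = f := by
  unfold shiftedComponent
  unfold shiftedPiece at hf
  split_ifs at hf ⊢
  · exact homogeneousComponent_eq_self hf
  · exact ((Submodule.mem_bot K).1 hf).symm

theorem shiftedComponent_sum {ι : Type*} (s : Finset ι) (d k : ℕ)
    (f : ι → MvPolynomial (Fin n) K) :
    shiftedComponent d k (∑ i ∈ s, f i) = ∑ i ∈ s, shiftedComponent d k (f i) := by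
  unfold shiftedComponent
  split_ifs
  · exact map_sum _ _ _
  · simp

theorem shiftedComponent_mul {a : MvPolynomial (Fin n) K} {e : ℕ} (ha : a.IsHomogeneous e)
    (d k : ℕ) (f : MvPolynomial (Fin n) K) :
    shiftedComponent d k (a * f) = a * shiftedComponent (d + e) k f := by
  unfold shiftedComponent
  rw [ha.homogeneousComponent_mul]
  by_cases h : d + e ≤ k
  · rw [if_pos (by omega), if_pos (by omega), if_pos h, Nat.sub_add_eq]
  · rw [if_neg h, mul_zero]
    split_ifs with h₁ h₂
    · omega
    · rfl
    · rfl

instance (d k : ℕ) : FiniteDimensional K (shiftedPiece K n d k) := by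
  by_cases h : d ≤ k
  · rw [shiftedPiece, if_pos h]; infer_instance
  · rw [shiftedPiece, if_neg h]; infer_instance

theorem finrank_homogeneousSubmodule (k : ℕ) :
    Module.finrank K (homogeneousSubmodule (Fin n) K k) =
      hilbertFunction (⊥ : Ideal (MvPolynomial (Fin n) K)) k := by
  rw [← hilbertFunction_add_finrank ⊥ k]
  have : gradedPiece (⊥ : Ideal (MvPolynomial (Fin n) K)) k = ⊥ := by
    rw [eq_bot_iff]
    exact fun f hf => hf.2
  rw [this, finrank_bot, add_zero]

theorem mk_finrank_shiftedPiece (d : ℕ) :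
    (PowerSeries.mk fun k => (Module.finrank K (shiftedPiece K n d k) : ℤ)) =
      PowerSeries.X ^ d * hilbertSeries (⊥ : Ideal (MvPolynomial (Fin n) K)) := by
  ext k
  rw [PowerSeries.coeff_X_pow_mul', PowerSeries.coeff_mk, hilbertSeries, PowerSeries.coeff_mk]
  by_cases h : d ≤ k
  · rw [if_pos h, shiftedPiece, if_pos h, finrank_homogeneousSubmodule]
  · rw [if_neg h, shiftedPiece, if_neg h, finrank_bot, Nat.cast_zero]

/-- The degree `k` component of `⨁ⱼ S(-dⱼ)`. -/
def gradedFree (K : Type*) [Field K] (n : ℕ) {r : ℕ} (d : Fin r → ℕ) (k : ℕ) :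
    Submodule K (Fin r → MvPolynomial (Fin n) K) :=
  Submodule.pi Set.univ fun j => shiftedPiece K n (d j) k

theorem mem_gradedFree {r : ℕ} {d : Fin r → ℕ} {k : ℕ} {v : Fin r → MvPolynomial (Fin n) K} :
    v ∈ gradedFree K n d k ↔ ∀ j, v j ∈ shiftedPiece K n (d j) k := by
  simp [gradedFree]

/-- The degree `k` component of a free module is the product of those of the summands. -/
def gradedFreeEquiv {r : ℕ} (d : Fin r → ℕ) (k : ℕ) :
    gradedFree K n d k ≃ₗ[K] ((j : Fin r) → shiftedPiece K n (d j) k) where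
  toFun v j := ⟨v.1 j, mem_gradedFree.1 v.2 j⟩
  map_add' _ _ := rfl
  map_smul' _ _ := rfl
  invFun w := ⟨fun j => w j, mem_gradedFree.2 fun j => (w j).2⟩
  left_inv _ := rfl
  right_inv _ := rfl

instance {r : ℕ} (d : Fin r → ℕ) (k : ℕ) : FiniteDimensional K (gradedFree K n d k) :=
  (gradedFreeEquiv d k).symm.finiteDimensional

theorem mk_finrank_gradedFree {r : ℕ} (d : Fin r → ℕ) :
    (PowerSeries.mk fun k => (Module.finrank K (gradedFree K n d k) : ℤ)) =
      (∑ j, PowerSeries.X ^ d j) * hilbertSeries (⊥ : Ideal (MvPolynomial (Fin n) K)) := by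
  rw [Finset.sum_mul]
  simp_rw [← mk_finrank_shiftedPiece]
  ext k
  rw [map_sum]
  simp only [PowerSeries.coeff_mk]
  rw [(gradedFreeEquiv d k).finrank_eq, Module.finrank_pi_fintype]
  push_cast
  rfl

/-- The projection of `⨁ⱼ S(-dⱼ)` onto its degree `k` component. -/
def gradedFreeComponent {r : ℕ} (d : Fin r → ℕ) (k : ℕ) (v : Fin r → MvPolynomial (Fin n) K) :
    Fin r → MvPolynomial (Fin n) K :=
  fun j => shiftedComponent (d j) k (v j)

theorem gradedFreeComponent_mem {r : ℕ} (d : Fin r → ℕ) (k : ℕ)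
    (v : Fin r → MvPolynomial (Fin n) K) : gradedFreeComponent d k v ∈ gradedFree K n d k :=
  mem_gradedFree.2 fun _ => shiftedComponent_mem _ _ _

theorem gradedFreeComponent_eq_self {r : ℕ} {d : Fin r → ℕ} {k : ℕ}
    {v : Fin r → MvPolynomial (Fin n) K} (hv : v ∈ gradedFree K n d k) :
    gradedFreeComponent d k v = v :=
  funext fun j => shiftedComponent_eq_self (mem_gradedFree.1 hv j)

/-- Compatibility with the projections onto degree `k` allows exactness, which is given for ungraded
modules, to be used one degree at a time. -/
theorem gradedFreeComponent_mulVec {r r' : ℕ} (d : Fin r → ℕ) (d' : Fin r' → ℕ)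
    (A : Matrix (Fin r) (Fin r') (MvPolynomial (Fin n) K))
    (hA : ∀ j c, A j c = 0 ∨ ∃ e, d' c = d j + e ∧ (A j c).IsHomogeneous e) (k : ℕ)
    (v : Fin r' → MvPolynomial (Fin n) K) :
    gradedFreeComponent d k (A.mulVecLin v) = A.mulVecLin (gradedFreeComponent d' k v) := by
  ext1 j
  simp only [gradedFreeComponent, Matrix.mulVecLin_apply, Matrix.mulVec, dotProduct]
  rw [shiftedComponent_sum]
  refine Finset.sum_congr rfl fun c _ => ?_
  obtain h | ⟨e, he, h⟩ := hA j c
  · rw [h, zero_mul, zero_mul]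
    exact shiftedComponent_eq_self (Submodule.zero_mem _)
  · rw [shiftedComponent_mul h, he]

end GradedFree

/-! ### The Hilbert series from the resolution, and consequences of minimality. -/

theorem alternating_sum_of_telescope {A : Type*} [CommRing A] (a R : ℕ → A) (H : A)
    (h₀ : a 0 = H + R 0) (h : ∀ i, a (i + 1) = R i + R (i + 1)) (p : ℕ) :
    ∑ i ∈ Finset.range (p + 1), (-1) ^ i * a i = H + (-1) ^ p * R p := by
  induction p with
  | zero => simp [h₀]
  | succ p ih => rw [Finset.sum_range_succ, ih, h]; ring

namespace MinimalGradedFreeResolution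

variable {K : Type*} [Field K] {n : ℕ} {I : Ideal (MvPolynomial (Fin n) K)}
  (F : MinimalGradedFreeResolution I)

/-- The image in degree `k` of the differential into step `i`. -/
def boundary (i k : ℕ) : Submodule K (Fin (F.rank i) → MvPolynomial (Fin n) K) :=
  (gradedFree K n (F.shift (i + 1)) k).map ((F.diff i).mulVecLin.restrictScalars K)

/-- By exactness a cycle of degree `k` is the image of some `w`, which may be replaced by its degree
`k` component. -/
theorem boundary_succ (i k : ℕ) : F.boundary (i + 1) k =
    gradedFree K n (F.shift (i + 1)) k ⊓
      LinearMap.ker ((F.diff i).mulVecLin.restrictScalars K) := by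
  apply le_antisymm
  · rintro _ ⟨w, hw, rfl⟩
    refine ⟨?_, (F.exact i _).2 ⟨w, rfl⟩⟩
    rw [← gradedFreeComponent_eq_self hw, LinearMap.restrictScalars_apply,
      ← gradedFreeComponent_mulVec _ _ _ (F.homogeneous (i + 1))]
    exact gradedFreeComponent_mem _ _ _
  · rintro v ⟨hv, hv'⟩
    obtain ⟨w, rfl⟩ := (F.exact i v).1 hv'
    refine ⟨_, gradedFreeComponent_mem _ k w, ?_⟩
    rw [LinearMap.restrictScalars_apply, ← gradedFreeComponent_mulVec _ _ _ (F.homogeneous (i + 1))]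
    exact gradedFreeComponent_eq_self hv

theorem finrank_gradedFree_succ (i k : ℕ) :
    Module.finrank K (gradedFree K n (F.shift (i + 1)) k) =
      Module.finrank K (F.boundary i k) + Module.finrank K (F.boundary (i + 1) k) := by
  rw [boundary_succ, boundary, Submodule.finrank_map_add_finrank_inf_ker]

theorem shiftedPiece_zero (k : ℕ) : shiftedPiece K n 0 k = homogeneousSubmodule (Fin n) K k := by
  simp [shiftedPiece]

theorem boundary_zero (k : ℕ) : F.boundary 0 k =
    (gradedPiece I k).map (LinearMap.pi fun _ => LinearMap.id) := by
  have hpos : 0 < F.rank 0 := by rw [F.rank_zero]; exact one_pos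
  -- `rank 0 = 1` holds only propositionally, so elements of the module at step `0` are treated as
  -- constant vectors.
  have hconst (v : Fin (F.rank 0) → MvPolynomial (Fin n) K) : v = fun _ => v ⟨0, hpos⟩ := by
    ext1 j
    congr 1
    ext
    have := F.rank_zero
    simp only
    omega
  have hmem (v : Fin (F.rank 0) → MvPolynomial (Fin n) K) (hv : v ∈ gradedFree K n (F.shift 0) k) :
      (v ⟨0, hpos⟩).IsHomogeneous k := by
    have := mem_gradedFree.1 hv ⟨0, hpos⟩
    rwa [F.shift_zero, shiftedPiece_zero] at this
  apply le_antisymm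
  · rintro _ ⟨w, hw, rfl⟩
    rw [LinearMap.restrictScalars_apply]
    refine ⟨(F.diff 0).mulVecLin w ⟨0, hpos⟩, ⟨hmem _ ?_, ?_⟩,
      (hconst ((F.diff 0).mulVecLin w)).symm⟩
    · rw [← gradedFreeComponent_eq_self hw, ← gradedFreeComponent_mulVec _ _ _ (F.homogeneous 0)]
      exact gradedFreeComponent_mem _ _ _
    · exact (F.range_eq _).1 ⟨w, hconst _⟩
  · rintro _ ⟨f, ⟨hf, hf'⟩, rfl⟩
    obtain ⟨w, hw⟩ := (F.range_eq f).2 hf'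
    refine ⟨_, gradedFreeComponent_mem _ k w, ?_⟩
    rw [LinearMap.restrictScalars_apply, ← gradedFreeComponent_mulVec _ _ _ (F.homogeneous 0), hw]
    refine gradedFreeComponent_eq_self (mem_gradedFree.2 fun j => ?_)
    rw [F.shift_zero, shiftedPiece_zero]
    exact hf

theorem finrank_boundary_zero (k : ℕ) :
    Module.finrank K (F.boundary 0 k) = Module.finrank K (gradedPiece I k) := by
  have hpos : 0 < F.rank 0 := by rw [F.rank_zero]; exact one_pos
  rw [boundary_zero]
  exact (Submodule.equivMapOfInjective _
    (fun f g h => congrFun h ⟨0, hpos⟩) _).finrank_eq.symm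

theorem sum_X_pow_shift_zero :
    (∑ j, (PowerSeries.X : PowerSeries ℤ) ^ F.shift 0 j) = 1 := by
  simp [F.shift_zero, F.rank_zero]

/-- The numerator `∑ᵢ (-1)ⁱ ∑ⱼ t ^ dᵢⱼ` of the Hilbert series. -/
def numerator : Polynomial ℤ :=
  ∑ i ∈ Finset.range (F.length + 1), (-1) ^ i * ∑ j, Polynomial.X ^ F.shift i j

/-- In each degree the dimension of a free module is the sum of two consecutive boundary dimensions,
so the alternating sum telescopes from `I` at step `0` to zero at the last step. A free module
contributes `∑ⱼ t ^ dᵢⱼ / (1 - t) ^ n`. -/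
theorem one_sub_X_pow_mul_hilbertSeries :
    (1 - PowerSeries.X) ^ n * hilbertSeries I = (F.numerator : PowerSeries ℤ) := by
  have key := alternating_sum_of_telescope
    (fun i => PowerSeries.mk fun k => (Module.finrank K (gradedFree K n (F.shift i) k) : ℤ))
    (fun i => PowerSeries.mk fun k => (Module.finrank K (F.boundary i k) : ℤ)) (hilbertSeries I)
    (by
      rw [mk_finrank_gradedFree, sum_X_pow_shift_zero, one_mul]
      ext k
      simp only [hilbertSeries, map_add, PowerSeries.coeff_mk]
      rw [← finrank_homogeneousSubmodule, ← hilbertFunction_add_finrank I k,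
        finrank_boundary_zero]
      push_cast; rfl)
    (fun i => by
      ext k
      simp only [map_add, PowerSeries.coeff_mk]
      rw [finrank_gradedFree_succ]
      push_cast; rfl) F.length
  have hz : (PowerSeries.mk fun k => (Module.finrank K (F.boundary F.length k) : ℤ)) = 0 := by
    ext k
    have : IsEmpty (Fin (F.rank (F.length + 1))) := by
      rw [F.rank_of_length_lt _ (Nat.lt_succ_self _)]
      infer_instance
    have hb : F.boundary F.length k = ⊥ := by
      rw [eq_bot_iff]
      rintro _ ⟨w, -, rfl⟩
      rw [Subsingleton.elim w 0, map_zero]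
      exact Submodule.zero_mem _
    rw [PowerSeries.coeff_mk, hb, finrank_bot]
    simp
  rw [hz, mul_zero, add_zero] at key
  simp_rw [mk_finrank_gradedFree, ← mul_assoc] at key
  rw [← Finset.sum_mul] at key
  rw [← key, mul_left_comm, one_sub_X_pow_mul_hilbertSeries_bot, mul_one, numerator,
    ← Polynomial.coeToPowerSeries.ringHom_apply]
  simp only [map_sum, map_mul, map_pow, map_neg, map_one, Polynomial.coeToPowerSeries.ringHom_apply,
    Polynomial.coe_X]

/-- If column `c` were zero, the basis vector `e_c` would be a cycle, hence a boundary, and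
minimality would put its coordinate `1` into the maximal ideal. -/
theorem exists_diff_ne_zero (i : ℕ) (c : Fin (F.rank (i + 1))) : ∃ j, F.diff i j c ≠ 0 := by
  by_contra! h
  have hz : (F.diff i).mulVecLin (Pi.single c 1) = 0 := by
    ext1 j
    simp [h j]
  obtain ⟨w, hw⟩ := (F.exact i _).1 hz
  have h1 : (F.diff (i + 1)).mulVecLin w c ∈ idealOfVars (Fin n) K := by
    rw [Matrix.mulVecLin_apply, Matrix.mulVec, dotProduct]
    exact Ideal.sum_mem _ fun l _ => Ideal.mul_mem_right _ _ (F.minimal (i + 1) c l)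
  rw [hw, Pi.single_eq_same] at h1
  exact isMaximal_idealOfVars.ne_top ((Ideal.eq_top_iff_one _).2 h1)

/-- An entry of degree `0` is a constant, and the only constant in `(x₁, …, xₙ)` is zero. -/
theorem shift_lt_shift_of_diff_ne_zero {i : ℕ} {j : Fin (F.rank i)} {c : Fin (F.rank (i + 1))}
    (h : F.diff i j c ≠ 0) : F.shift i j < F.shift (i + 1) c := by
  obtain h' | ⟨e, he, h'⟩ := F.homogeneous i j c
  · exact absurd h' h
  rcases Nat.eq_zero_or_pos e with rfl | hpos
  · refine absurd ?_ h
    rw [← homogeneousComponent_eq_self h', homogeneousComponent_zero,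
      mem_idealOfVars_iff.1 (F.minimal i j c), C_0]
  · omega

theorem rank_ne_zero {i : ℕ} (hi : i ≤ F.length) : F.rank i ≠ 0 := by
  induction hi using Nat.decreasingInduction with
  | self => exact F.rank_length
  | of_succ k hk ih =>
    obtain ⟨j, -⟩ := F.exists_diff_ne_zero k ⟨0, Nat.pos_of_ne_zero ih⟩
    exact Nat.ne_of_gt j.pos

theorem minShift_le (i : ℕ) (j : Fin (F.rank i)) : F.minShift i ≤ F.shift i j :=
  ciInf_le (OrderBot.bddBelow _) j

theorem le_maxShift (i : ℕ) (j : Fin (F.rank i)) : F.shift i j ≤ F.maxShift i :=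
  le_ciSup (Set.finite_range _).bddAbove j

theorem minShift_lt_shift_succ (i : ℕ) (c : Fin (F.rank (i + 1))) :
    F.minShift i < F.shift (i + 1) c := by
  obtain ⟨j, hj⟩ := F.exists_diff_ne_zero i c
  exact (F.minShift_le i j).trans_lt (F.shift_lt_shift_of_diff_ne_zero hj)

theorem exists_shift_eq_minShift {i : ℕ} (hi : i ≤ F.length) : ∃ j, F.shift i j = F.minShift i := by
  have : Nonempty (Fin (F.rank i)) := ⟨⟨0, Nat.pos_of_ne_zero (F.rank_ne_zero hi)⟩⟩
  exact exists_eq_ciInf_of_finite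

theorem exists_shift_eq_maxShift {i : ℕ} (hi : i ≤ F.length) : ∃ j, F.shift i j = F.maxShift i := by
  have : Nonempty (Fin (F.rank i)) := ⟨⟨0, Nat.pos_of_ne_zero (F.rank_ne_zero hi)⟩⟩
  exact exists_eq_ciSup_of_finite

end MinimalGradedFreeResolution

/-! ### Ext and regular sequences over a commutative ring. -/

section ExtGeneral

open CategoryTheory Abelian

universe u

variable {R : Type u} [CommRing R]

theorem Ext.smul_eq_zero_of_mem_annihilator {N M : ModuleCat.{u} R} {r : R}
    (h : r ∈ Module.annihilator R N) {i : ℕ} (x : Ext N M i) : r • x = 0 := by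
  have h0 : r • 𝟙 N = 0 := by
    ext y
    exact Module.mem_annihilator.1 h y
  have : r • x = (Ext.mk₀ (r • 𝟙 N)).comp x (zero_add i) := by simp [Ext.mk₀_smul]
  rw [this, h0, Ext.mk₀_zero, Ext.zero_comp]

/-- A matrix with entries in the annihilator of `N` acts as zero on `Ext N`. -/
theorem Ext.comp_mulVecLin_eq_zero {N : ModuleCat.{u} R} {r r' : ℕ} (A : Matrix (Fin r) (Fin r') R)
    (hA : ∀ j c, A j c ∈ Module.annihilator R N) {i : ℕ}
    (x : Ext N (ModuleCat.of R (Fin r' → R)) i) :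
    x.comp (Ext.mk₀ (ModuleCat.ofHom A.mulVecLin)) (add_zero i) = 0 := by
  have : ModuleCat.ofHom A.mulVecLin = ∑ jc : Fin r × Fin r', A jc.1 jc.2 •
      ModuleCat.ofHom (LinearMap.single R (fun _ : Fin r => R) jc.1 ∘ₗ
        LinearMap.proj (φ := fun _ : Fin r' => R) jc.2) := by
    ext v j
    simp [Fintype.sum_prod_type, Matrix.mulVec, dotProduct, Pi.single_apply]
  rw [this, Ext.mk₀_sum, Ext.comp_sum]
  refine Finset.sum_eq_zero fun jc _ => ?_
  rw [Ext.mk₀_smul, Ext.comp_smul]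
  exact Ext.smul_eq_zero_of_mem_annihilator (hA _ _) _

theorem Ext.subsingleton_pi {N : ModuleCat.{u} R} {i : ℕ}
    (h : Subsingleton (Ext N (ModuleCat.of R R) i))
    (r : ℕ) : Subsingleton (Ext N (ModuleCat.of R (Fin r → R)) i) := by
  refine subsingleton_of_forall_eq 0 fun x => ?_
  have : 𝟙 (ModuleCat.of R (Fin r → R)) = ∑ j : Fin r,
      ModuleCat.ofHom (LinearMap.proj (φ := fun _ : Fin r => R) j) ≫
        ModuleCat.ofHom (LinearMap.single R (fun _ : Fin r => R) j) := by
    ext v j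
    simp [Pi.single_apply]
  rw [← Ext.comp_mk₀_id x, this, Ext.mk₀_sum, Ext.comp_sum]
  refine Finset.sum_eq_zero fun j _ => ?_
  rw [← Ext.mk₀_comp_mk₀, ← Ext.comp_assoc_of_third_deg_zero,
    Subsingleton.elim (x.comp (Ext.mk₀ (ModuleCat.ofHom (LinearMap.proj j))) _) 0, Ext.zero_comp]

theorem Ext.nontrivial_pi {N : ModuleCat.{u} R} {i : ℕ}
    (h : Nontrivial (Ext N (ModuleCat.of R R) i))
    {r : ℕ} (hr : r ≠ 0) : Nontrivial (Ext N (ModuleCat.of R (Fin r → R)) i) := by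
  obtain ⟨x, hx⟩ := exists_ne (0 : Ext N (ModuleCat.of R R) i)
  let j : Fin r := ⟨0, Nat.pos_of_ne_zero hr⟩
  refine nontrivial_of_ne (x.comp (Ext.mk₀ (ModuleCat.ofHom
    (LinearMap.single R (fun _ : Fin r => R) j))) (add_zero i)) 0 fun h => hx ?_
  have h' := congrArg (fun y => y.comp (Ext.mk₀ (ModuleCat.ofHom
    (LinearMap.proj (φ := fun _ : Fin r => R) j))) (add_zero i)) h
  rw [Ext.zero_comp, Ext.comp_assoc_of_third_deg_zero, Ext.mk₀_comp_mk₀, ← ModuleCat.ofHom_comp,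
    LinearMap.proj_comp_single_same] at h'
  rwa [ModuleCat.ofHom_id, Ext.comp_mk₀_id] at h'

/-- A regular element lies in no minimal prime of the support, so each member of the sequence lowers
the dimension by at least one. -/
theorem RingTheory.Sequence.IsRegular.length_le_supportDim [IsNoetherianRing R] {M : Type u}
    [AddCommGroup M] [Module R M] [Module.Finite R M] {rs : List R}
    (h : RingTheory.Sequence.IsRegular M rs) :
    (rs.length : WithBot ℕ∞) ≤ Module.supportDim R M := by
  induction rs generalizing M with
  | nil =>
    have := h.nontrivial
    have := Module.supportDim_ne_bot_of_nontrivial R M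
    rw [List.length_nil, Nat.cast_zero]
    exact Order.krullDim_nonneg_iff.2 (Order.krullDim_ne_bot_iff.1 this)
  | cons r rs ih =>
    rw [RingTheory.Sequence.isRegular_cons_iff] at h
    refine le_trans ?_ (Module.supportDim_quotSMulTop_succ_le_of_notMem_minimalPrimes
      (x := r) fun p hp => h.1.notMem_of_mem_minimalPrimes hp)
    rw [List.length_cons]
    push_cast
    exact add_le_add_left (ih h.2) 1

/-- Multiplication by `a` as a map `R/J → R/I`. -/
def quotientMulMap (I J : Ideal R) (a : R) (hJ : ∀ x, x ∈ J ↔ a * x ∈ I) :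
    R ⧸ J →ₗ[R] R ⧸ I :=
  Submodule.liftQ J (I.mkQ ∘ₗ LinearMap.mulLeft R a) fun x hx => by
    rw [LinearMap.mem_ker, LinearMap.comp_apply, Submodule.mkQ_apply, Submodule.Quotient.mk_eq_zero]
    exact (hJ x).1 hx

theorem quotientMulMap_mk (I J : Ideal R) (a : R) (hJ : ∀ x, x ∈ J ↔ a * x ∈ I) (x : R) :
    quotientMulMap I J a hJ (Submodule.Quotient.mk x) = Submodule.Quotient.mk (a * x) := rfl

theorem quotientMulMap_injective (I J : Ideal R) (a : R) (hJ : ∀ x, x ∈ J ↔ a * x ∈ I) :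
    Function.Injective (quotientMulMap I J a hJ) := by
  rw [injective_iff_map_eq_zero]
  intro y hy
  obtain ⟨x, rfl⟩ := Submodule.Quotient.mk_surjective _ y
  rw [quotientMulMap_mk, Submodule.Quotient.mk_eq_zero] at hy
  exact (Submodule.Quotient.mk_eq_zero _).2 ((hJ x).2 hy)

theorem exact_quotientMulMap_factor (I J : Ideal R) (a : R) (hJ : ∀ x, x ∈ J ↔ a * x ∈ I) :
    Function.Exact (quotientMulMap I J a hJ)
      (Submodule.factor (le_sup_left : I ≤ I ⊔ Ideal.span {a})) := by
  intro y
  obtain ⟨x, rfl⟩ := Submodule.Quotient.mk_surjective _ y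
  rw [← Submodule.mkQ_apply, Submodule.factor_mk, Submodule.mkQ_apply, Submodule.mkQ_apply,
    Submodule.Quotient.mk_eq_zero]
  constructor
  · intro hx
    obtain ⟨b, c, hc, rfl⟩ := Ideal.mem_span_singleton_sup.1 (sup_comm I _ ▸ hx)
    refine ⟨Submodule.Quotient.mk b, ?_⟩
    rw [quotientMulMap_mk, Submodule.Quotient.eq, mul_comm a b, sub_add_cancel_left]
    exact I.neg_mem hc
  · rintro ⟨z, hz⟩
    obtain ⟨b, rfl⟩ := Submodule.Quotient.mk_surjective _ z
    rw [quotientMulMap_mk, Submodule.Quotient.eq] at hz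
    rw [← sub_sub_cancel (a * b) x]
    exact Ideal.sub_mem _ (Ideal.mem_sup_right (Ideal.mem_span_singleton.2 ⟨b, rfl⟩))
      (Ideal.mem_sup_left hz)

/-- The sequence `0 → R/J → R/I → R/(I + (a)) → 0` with `J = (I : a)`. -/
abbrev colonShortComplex (I J : Ideal R) (a : R) (hJ : ∀ x, x ∈ J ↔ a * x ∈ I) :
    ShortComplex (ModuleCat.{u} R) :=
  ModuleCat.shortComplexOfCompEqZero (quotientMulMap I J a hJ)
    (Submodule.factor (le_sup_left : I ≤ I ⊔ Ideal.span {a}))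
    (exact_quotientMulMap_factor I J a hJ).linearMap_comp_eq_zero

theorem colonShortComplex_shortExact (I J : Ideal R) (a : R) (hJ : ∀ x, x ∈ J ↔ a * x ∈ I) :
    (colonShortComplex I J a hJ).ShortExact :=
  ModuleCat.shortComplex_shortExact _ (exact_quotientMulMap_factor I J a hJ)
    (quotientMulMap_injective I J a hJ) (Submodule.factor_surjective le_sup_left)

/-- If `r E ⊆ a E` for a finite module `E`, some element congruent to a power of `r` modulo an
ideal containing `a` annihilates `E`. -/
theorem exists_notMem_forall_smul_eq_zero {E : Type*} [AddCommGroup E] [Module R E]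
    [Module.Finite R E] {P : Ideal R} [P.IsPrime] {r a : R} (hr : r ∉ P) (ha : a ∈ P)
    (h : ∀ x : E, ∃ y : E, r • x = a • y) : ∃ q ∉ P, ∀ x : E, q • x = 0 := by
  -- Determinant trick: multiplication by `r` maps `E` into `P E`, so it is a root of a monic `p`
  -- whose lower coefficients lie in `P`. Then `p(r)` kills `E` and is a power of `r` modulo `P`.
  obtain ⟨p, hp, -, hc, hz⟩ :=
    LinearMap.exists_monic_and_natDegree_eq_and_coeff_mem_pow_and_aeval_eq_zero R
      (algebraMap R (Module.End R E) r) P (by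
        rintro _ ⟨x, rfl⟩
        obtain ⟨y, hy⟩ := h x
        rw [Module.algebraMap_end_apply, hy]
        exact Submodule.smul_mem_smul ha trivial)
  refine ⟨p.eval r, fun hmem => hr ?_, fun x => ?_⟩
  · rw [Polynomial.eval_eq_sum_range, Finset.sum_range_succ, hp.coeff_natDegree, one_mul] at hmem
    refine Ideal.IsPrime.mem_of_pow_mem ‹_› p.natDegree ((Ideal.add_mem_iff_right _ ?_).1 hmem)
    refine Ideal.sum_mem _ fun k hk => Ideal.mul_mem_right _ _ ?_
    refine Ideal.pow_le_self ?_ (hc k)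
    have := Finset.mem_range.1 hk
    omega
  · rw [Polynomial.aeval_algebraMap_apply, Polynomial.coe_aeval_eq_eval] at hz
    have := LinearMap.congr_fun hz x
    rwa [Module.algebraMap_end_apply] at this

end ExtGeneral

/-! ### Ext over the polynomial ring: depth and grade. -/

section ExtPolynomial

open CategoryTheory Abelian

universe u

variable {K : Type u} [Field K] {n : ℕ}

/-- The residue field `S/(x₁, …, xₙ)`. -/
abbrev residueModule (K : Type u) [Field K] (n : ℕ) : ModuleCat.{u} (MvPolynomial (Fin n) K) :=
  ModuleCat.of _ (MvPolynomial (Fin n) K ⧸ idealOfVars (Fin n) K)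

theorem isRegular_variables :
    RingTheory.Sequence.IsRegular (MvPolynomial (Fin n) K)
      (List.ofFn fun i : Fin n => (X i : MvPolynomial (Fin n) K)) := by
  have hofList (i : ℕ) (hi : i ≤ n) :
      Ideal.ofList ((List.ofFn fun i : Fin n => (X i : MvPolynomial (Fin n) K)).take i) =
        Ideal.span (X '' {j : Fin n | (j : ℕ) < i}) := by
    rw [Ideal.ofList]
    congr 1
    ext f
    simp only [Set.mem_ofPred_eq, Set.mem_image]
    rw [List.mem_take_iff_getElem]
    simp only [List.length_ofFn, List.getElem_ofFn]
    constructor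
    · rintro ⟨j, hj, rfl⟩
      exact ⟨⟨j, by omega⟩, by simp only; omega, rfl⟩
    · rintro ⟨j, hj, rfl⟩
      exact ⟨j, by omega, rfl⟩
  refine ⟨⟨fun i hi => ?_⟩, fun h => ?_⟩
  · rw [List.length_ofFn] at hi
    rw [List.getElem_ofFn, isSMulRegular_iff_right_eq_zero_of_smul]
    intro y hy
    obtain ⟨f, rfl⟩ := Submodule.Quotient.mk_surjective _ y
    rw [← Submodule.Quotient.mk_smul, Submodule.Quotient.mk_eq_zero, hofList i hi.le, smul_eq_mul,
      Ideal.mul_top] at hy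
    rw [Submodule.Quotient.mk_eq_zero, hofList i hi.le, smul_eq_mul, Ideal.mul_top]
    exact X_mul_mem_span_X_image (by simp) hy
  · refine isMaximal_idealOfVars (K := K) (n := n).ne_top (top_le_iff.1 ?_)
    rw [h, smul_eq_mul, Ideal.mul_top, Ideal.ofList, Ideal.span_le]
    rintro _ hf
    obtain ⟨i, rfl⟩ := (List.mem_ofFn' _ _).1 hf
    exact Ideal.subset_span ⟨i, rfl⟩

theorem idealOfVars_smul_top_lt {I : Ideal (MvPolynomial (Fin n) K)}
    (hI : I ≤ idealOfVars (Fin n) K) :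
    idealOfVars (Fin n) K • (⊤ : Submodule (MvPolynomial (Fin n) K) (MvPolynomial (Fin n) K ⧸ I)) <
      ⊤ := by
  refine lt_top_iff_ne_top.2 fun h => (isMaximal_idealOfVars (K := K) (n := n)).ne_top
    (top_le_iff.1 fun f _ => ?_)
  have hle : idealOfVars (Fin n) K •
      (⊤ : Submodule (MvPolynomial (Fin n) K) (MvPolynomial (Fin n) K ⧸ I)) ≤
        Submodule.map (Submodule.mkQ I) (idealOfVars (Fin n) K) := by
    refine Submodule.smul_le.2 fun a ha y _ => ?_
    obtain ⟨b, rfl⟩ := Submodule.Quotient.mk_surjective _ y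
    exact ⟨a * b, Ideal.mul_mem_right _ _ ha, rfl⟩
  rw [h] at hle
  obtain ⟨g, hg, hgf⟩ := hle (show Submodule.mkQ I f ∈ ⊤ from trivial)
  rw [← sub_sub_cancel g f]
  exact Ideal.sub_mem _ hg (hI ((Submodule.Quotient.eq I).1 hgf))

theorem residue_support : Module.support (MvPolynomial (Fin n) K) (residueModule K n) =
    PrimeSpectrum.zeroLocus (idealOfVars (Fin n) K : Set (MvPolynomial (Fin n) K)) := by
  rw [Module.support_eq_zeroLocus, Ideal.annihilator_quotient]

theorem idealOfVars_smul_top_self_lt :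
    idealOfVars (Fin n) K • (⊤ : Submodule (MvPolynomial (Fin n) K) (MvPolynomial (Fin n) K)) <
      ⊤ := by
  rw [smul_eq_mul, Ideal.mul_top]
  exact lt_top_iff_ne_top.2 isMaximal_idealOfVars.ne_top

theorem subsingleton_ext_residue_self {i : ℕ} (hi : i < n) :
    Subsingleton (Ext (residueModule K n)
      (ModuleCat.of (MvPolynomial (Fin n) K) (MvPolynomial (Fin n) K)) i) :=
  ModuleCat.subsingleton_ext_of_exists_isRegular (idealOfVars (Fin n) K) (residueModule K n)
    residue_support.le (ModuleCat.of _ (MvPolynomial (Fin n) K)) idealOfVars_smul_top_self_lt _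
    (by
      intro f hf
      obtain ⟨i, rfl⟩ := (List.mem_ofFn' _ _).1 hf
      exact Ideal.subset_span ⟨i, rfl⟩)
    isRegular_variables i (by rwa [List.length_ofFn])

theorem ringKrullDim_mvPolynomial_fin : ringKrullDim (MvPolynomial (Fin n) K) = n := by
  rw [MvPolynomial.ringKrullDim_of_isNoetherianRing, ringKrullDim_eq_zero_of_field, zero_add,
    Nat.card_eq_fintype_card, Fintype.card_fin]

/-- Otherwise `Ext^i(K, S)` would vanish for all `i ≤ n`, and Rees's criterion would give a regular
sequence of length `n + 1 > dim S`. -/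
theorem nontrivial_ext_residue_self : Nontrivial (Ext (residueModule K n)
    (ModuleCat.of (MvPolynomial (Fin n) K) (MvPolynomial (Fin n) K)) n) := by
  by_contra h
  rw [not_nontrivial_iff_subsingleton] at h
  obtain ⟨rs, hlen, -, hreg⟩ := ModuleCat.exists_isRegular_of_exists_subsingleton_ext
    (idealOfVars (Fin n) K) (n + 1) (ModuleCat.of _ (MvPolynomial (Fin n) K))
    idealOfVars_smul_top_self_lt (residueModule K n) residue_support fun i hi => by
      rcases Nat.lt_succ_iff_lt_or_eq.1 hi with hi | rfl
      · exact subsingleton_ext_residue_self hi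
      · exact h
  have := hreg.length_le_supportDim
  rw [hlen] at this
  have h2 : Module.supportDim (MvPolynomial (Fin n) K) (MvPolynomial (Fin n) K) = n :=
    (Module.supportDim_self_eq_ringKrullDim _).trans ringKrullDim_mvPolynomial_fin
  have h3 := this.trans_eq h2
  norm_cast at h3
  omega

/-- A Cohen–Macaulay quotient has `Ext^i(K, S/I) = 0` for `i < dim S/I`. -/
theorem subsingleton_ext_residue_quotient {I : Ideal (MvPolynomial (Fin n) K)}
    (hI : I ≤ idealOfVars (Fin n) K) {rs : List (MvPolynomial (Fin n) K ⧸ I)}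
    (hrs : RingTheory.Sequence.IsRegular (MvPolynomial (Fin n) K ⧸ I) rs)
    (hmem : ∀ r ∈ rs, r ∈ (idealOfVars (Fin n) K).map (Ideal.Quotient.mk I))
    {i : ℕ} (hi : i < rs.length) :
    Subsingleton (Ext (residueModule K n)
      (ModuleCat.of (MvPolynomial (Fin n) K) (MvPolynomial (Fin n) K ⧸ I)) i) := by
  -- The sequence lies in `S/I`, while Ext is taken over `S`; lifts to `S` act on `S/I` in the same
  -- way.
  have hlift : ∃ rs' : List (MvPolynomial (Fin n) K),
      (∀ r ∈ rs', r ∈ idealOfVars (Fin n) K) ∧ rs'.map (Ideal.Quotient.mk I) = rs := by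
    clear hrs hi
    induction rs with
    | nil => exact ⟨[], by simp, rfl⟩
    | cons r rs ih =>
      obtain ⟨rs', h₁, h₂⟩ := ih fun r' hr' => hmem r' (List.mem_cons_of_mem _ hr')
      obtain ⟨r', h₃, h₄⟩ := (Ideal.mem_map_iff_of_surjective _ Ideal.Quotient.mk_surjective).1
        (hmem r List.mem_cons_self)
      refine ⟨r' :: rs', ?_, by rw [List.map_cons, h₂, h₄]⟩
      rintro x hx
      rcases List.mem_cons.1 hx with rfl | hx
      · exact h₃
      · exact h₁ x hx
  obtain ⟨rs', h₁, rfl⟩ := hlift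
  have hw : RingTheory.Sequence.IsWeaklyRegular (MvPolynomial (Fin n) K ⧸ I) rs' :=
    (RingTheory.Sequence.isWeaklyRegular_map_algebraMap_iff (MvPolynomial (Fin n) K ⧸ I)
      (MvPolynomial (Fin n) K ⧸ I) rs').1 hrs.1
  have hlt := idealOfVars_smul_top_lt hI
  have hreg : RingTheory.Sequence.IsRegular (MvPolynomial (Fin n) K ⧸ I) rs' := by
    refine ⟨hw, fun h => hlt.ne (top_le_iff.1 ?_)⟩
    nth_rw 1 [h]
    exact Submodule.smul_mono_left (Ideal.span_le.2 h₁)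
  exact ModuleCat.subsingleton_ext_of_exists_isRegular (idealOfVars (Fin n) K) (residueModule K n)
    residue_support.le (ModuleCat.of _ (MvPolynomial (Fin n) K ⧸ I)) hlt rs' h₁ hreg i
    (by simpa using hi)

/-- For a homogeneous ideal `I`, the module `Ext^i(S/I, S)` vanishes at the origin for
`i < n - dim S/I`. -/
theorem exists_notMem_smul_ext_eq_zero {I : Ideal (MvPolynomial (Fin n) K)}
    (hI : I.IsHomogeneous (homogeneousSubmodule (Fin n) K)) (i : ℕ)
    (hi : ringKrullDim (MvPolynomial (Fin n) K ⧸ I) + i < n) :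
    ∃ r ∉ idealOfVars (Fin n) K,
      ∀ x : Ext (ModuleCat.of (MvPolynomial (Fin n) K) (MvPolynomial (Fin n) K ⧸ I))
        (ModuleCat.of _ (MvPolynomial (Fin n) K)) i, r • x = 0 := by
  have hone : (1 : MvPolynomial (Fin n) K) ∉ idealOfVars (Fin n) K := fun h =>
    isMaximal_idealOfVars.ne_top ((Ideal.eq_top_iff_one _).2 h)
  have hprime : (idealOfVars (Fin n) K).IsPrime := isMaximal_idealOfVars.isPrime
  revert i
  refine homogeneousIdeal_induction (C := fun I => ∀ i : ℕ,
    ringKrullDim (MvPolynomial (Fin n) K ⧸ I) + i < n → ∃ r ∉ idealOfVars (Fin n) K,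
      ∀ x : Ext (ModuleCat.of (MvPolynomial (Fin n) K) (MvPolynomial (Fin n) K ⧸ I))
        (ModuleCat.of _ (MvPolynomial (Fin n) K)) i, r • x = 0) ?_ ?_ ?_ ?_ I hI
  · intro i _
    refine ⟨1, hone, fun x => Ext.smul_eq_zero_of_mem_annihilator ?_ x⟩
    rw [Ideal.annihilator_quotient]
    trivial
  · intro i hi
    have h0 : ringKrullDim (MvPolynomial (Fin n) K ⧸ idealOfVars (Fin n) K) = 0 := by
      have := isMaximal_idealOfVars (K := K) (n := n)
      let := Ideal.Quotient.field (idealOfVars (Fin n) K)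
      exact ringKrullDim_eq_zero_of_field _
    rw [h0, zero_add] at hi
    have := subsingleton_ext_residue_self (K := K) (n := n) (i := i) (by exact_mod_cast hi)
    exact ⟨1, hone, fun x => Subsingleton.elim _ _⟩
  · intro I hI hP j hj ih i hi
    -- For a prime `I` the colon ideal is `I` itself, so the first map of the sequence is the
    -- endomorphism `x_j` of `S/I`.
    have hJ : ∀ x, x ∈ I ↔ X j * x ∈ I := fun x =>
      ⟨fun h => I.mul_mem_left _ h, fun h => (hP.mem_or_mem h).resolve_left hj⟩
    obtain ⟨r, hr, hr'⟩ := ih (i + 1) (by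
      refine lt_of_le_of_lt ?_ hi
      have := ringKrullDim_quotient_sup_span_succ_le hj
      push_cast
      rw [add_comm (i : WithBot ℕ∞) 1, ← add_assoc]
      exact add_le_add_left this _)
    have hS := colonShortComplex_shortExact I I (X j) hJ
    have hf : (colonShortComplex I I (X j) hJ).f =
        (X j : MvPolynomial (Fin n) K) • 𝟙 _ := by
      refine ModuleCat.hom_ext (LinearMap.ext fun y => ?_)
      obtain ⟨x, rfl⟩ := Submodule.Quotient.mk_surjective _ y
      rfl
    -- The long exact sequence gives `r E ⊆ x_j E` for `E = Ext^i(S/I, S)`. The determinant trick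
    -- acts as Nakayama's lemma without a grading on `E`, which is why the conclusion is an
    -- annihilator outside the maximal ideal.
    refine exists_notMem_forall_smul_eq_zero hr
      (Ideal.subset_span ⟨j, rfl⟩ : X j ∈ idealOfVars (Fin n) K) fun x => ?_
    obtain ⟨y, hy⟩ := Ext.contravariant_sequence_exact₁ hS _ (r • x) (add_comm 1 i) (by
      rw [Ext.comp_smul]
      exact hr' _)
    refine ⟨y, ?_⟩
    rw [← hy, hf, Ext.mk₀_smul, Ext.smul_comp, Ext.mk₀_id_comp]
  · intro I hI e a ha ha' ih₁ ih₂ i hi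
    have hJ : ∀ x, x ∈ I.colon {a} ↔ a * x ∈ I := fun x => by
      rw [Submodule.mem_colon_singleton, smul_eq_mul, mul_comm]
    have hS := colonShortComplex_shortExact I (I.colon {a}) a hJ
    obtain ⟨r₁, hr₁, h₁⟩ := ih₁ i (lt_of_le_of_lt
      (add_le_add_left (ringKrullDim_quotient_le_of_le le_sup_left) _) hi)
    obtain ⟨r₂, hr₂, h₂⟩ := ih₂ i (lt_of_le_of_lt
      (add_le_add_left (ringKrullDim_quotient_le_of_le (le_colon_singleton I a)) _) hi)
    refine ⟨r₁ * r₂, fun h => (hprime.mem_or_mem h).elim hr₁ hr₂, fun x => ?_⟩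
    obtain ⟨y, hy⟩ := Ext.contravariant_sequence_exact₂ hS _ (r₂ • x) (by
      rw [Ext.comp_smul]
      exact h₂ _)
    rw [mul_smul, ← hy, ← Ext.comp_smul, h₁ y, Ext.comp_zero]

end ExtPolynomial

/-! ### Ext along the syzygies: the length and the rows of the differentials. -/

namespace MinimalGradedFreeResolution

open CategoryTheory Abelian

universe u

variable {K : Type u} [Field K] {n : ℕ} {I : Ideal (MvPolynomial (Fin n) K)}
  (F : MinimalGradedFreeResolution I)

/-- The `i`-th syzygy module, presented as the cokernel of the differential into step `i`. -/
abbrev Syzygy (i : ℕ) : Type u :=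
  (Fin (F.rank i) → MvPolynomial (Fin n) K) ⧸ LinearMap.range (F.diff i).mulVecLin

/-- The embedding of the `(i+1)`-st syzygy module into the `i`-th free module. -/
def syzygyInclusion (i : ℕ) :
    F.Syzygy (i + 1) →ₗ[MvPolynomial (Fin n) K] (Fin (F.rank i) → MvPolynomial (Fin n) K) :=
  Submodule.liftQ _ (F.diff i).mulVecLin fun v hv => (F.exact i v).2 hv

theorem syzygyInclusion_mk (i : ℕ) (v : Fin (F.rank (i + 1)) → MvPolynomial (Fin n) K) :
    F.syzygyInclusion i (Submodule.Quotient.mk v) = (F.diff i).mulVecLin v := rfl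

theorem syzygyInclusion_injective (i : ℕ) : Function.Injective (F.syzygyInclusion i) := by
  rw [injective_iff_map_eq_zero]
  intro y hy
  obtain ⟨v, rfl⟩ := Submodule.Quotient.mk_surjective _ y
  rw [syzygyInclusion_mk] at hy
  exact (Submodule.Quotient.mk_eq_zero _).2 ((F.exact i v).1 hy)

theorem exact_syzygyInclusion_mkQ (i : ℕ) :
    Function.Exact (F.syzygyInclusion i) (LinearMap.range (F.diff i).mulVecLin).mkQ := by
  intro v
  rw [Submodule.mkQ_apply, Submodule.Quotient.mk_eq_zero]
  constructor
  · rintro ⟨w, rfl⟩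
    exact ⟨Submodule.Quotient.mk w, rfl⟩
  · rintro ⟨y, rfl⟩
    obtain ⟨w, rfl⟩ := Submodule.Quotient.mk_surjective _ y
    exact ⟨w, rfl⟩

/-- The sequence from the `(i+1)`-st syzygy module through the `i`-th free module to the `i`-th
syzygy module. -/
abbrev syzygyShortComplex (i : ℕ) : ShortComplex (ModuleCat.{u} (MvPolynomial (Fin n) K)) :=
  ModuleCat.shortComplexOfCompEqZero (F.syzygyInclusion i)
    (LinearMap.range (F.diff i).mulVecLin).mkQ
    (F.exact_syzygyInclusion_mkQ i).linearMap_comp_eq_zero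

theorem syzygyShortComplex_shortExact (i : ℕ) : (F.syzygyShortComplex i).ShortExact :=
  ModuleCat.shortComplex_shortExact _ (F.exact_syzygyInclusion_mkQ i)
    (F.syzygyInclusion_injective i) (Submodule.mkQ_surjective _)

/-- The zeroth syzygy module is `S/I`. -/
def syzygyZeroEquiv : F.Syzygy 0 ≃ₗ[MvPolynomial (Fin n) K] MvPolynomial (Fin n) K ⧸ I :=
  let e : Fin (F.rank 0) ≃ Unit := (finCongr F.rank_zero).trans (Equiv.ofUnique _ _)
  Submodule.Quotient.equiv _ _
    ((LinearEquiv.funCongrLeft _ _ e.symm).trans (LinearEquiv.funUnique Unit _ _)) (by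
      ext f
      rw [← F.range_eq]
      constructor
      · rintro ⟨v, hv, rfl⟩
        have : v = fun _ => v (e.symm ()) :=
          funext fun j => congrArg v (e.injective (Subsingleton.elim _ _))
        rw [this] at hv
        exact hv
      · exact fun hf => ⟨_, hf, rfl⟩)

theorem residue_annihilator : Module.annihilator (MvPolynomial (Fin n) K) (residueModule K n) =
    idealOfVars (Fin n) K :=
  Ideal.annihilator_quotient

theorem isEmpty_of_length_lt {i : ℕ} (hi : F.length < i) : IsEmpty (Fin (F.rank i)) := by
  rw [F.rank_of_length_lt i hi]
  infer_instance

/-- The module at step `p + 1` is zero, so the projection from the last free module is injective on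
`Ext^n(K, -)`, and that module is free of nonzero rank. -/
theorem nontrivial_ext_syzygy_length :
    ∃ x : Ext (residueModule K n) (ModuleCat.of _ (F.Syzygy F.length)) n, x ≠ 0 := by
  have := Ext.nontrivial_pi (nontrivial_ext_residue_self (K := K) (n := n)) F.rank_length
  obtain ⟨x, hx⟩ := exists_ne (0 : Ext (residueModule K n) (ModuleCat.of _
    (Fin (F.rank F.length) → MvPolynomial (Fin n) K)) n)
  refine ⟨x.comp (Ext.mk₀ (F.syzygyShortComplex F.length).g) (add_zero n), fun h => hx ?_⟩
  obtain ⟨y, rfl⟩ := Ext.covariant_sequence_exact₂ _ (F.syzygyShortComplex_shortExact F.length) x h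
  have hz : (F.syzygyShortComplex F.length).f = 0 := by
    refine ModuleCat.hom_ext (LinearMap.ext fun y => ?_)
    obtain ⟨w, rfl⟩ := Submodule.Quotient.mk_surjective _ y
    have := F.isEmpty_of_length_lt (Nat.lt_succ_self F.length)
    rw [Subsingleton.elim w 0, Submodule.Quotient.mk_zero]
    exact map_zero _
  rw [hz, Ext.mk₀_zero, Ext.comp_zero]

/-- Up to an isomorphism the last inclusion is the matrix `diff i`, whose entries annihilate `K` by
minimality. -/
theorem ext_comp_syzygyInclusion_length {i : ℕ} (hi : i + 1 = F.length) {m : ℕ}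
    (x : Ext (residueModule K n) (ModuleCat.of _ (F.Syzygy (i + 1))) m) :
    x.comp (Ext.mk₀ (F.syzygyShortComplex i).f) (add_zero m) = 0 := by
  have hempty := F.isEmpty_of_length_lt (i := i + 1 + 1) (by omega)
  have hbot : LinearMap.range (F.diff (i + 1)).mulVecLin = ⊥ := by
    rw [eq_bot_iff]
    rintro _ ⟨w, rfl⟩
    rw [Subsingleton.elim w 0, map_zero]
    exact Submodule.zero_mem _
  have hf : (F.syzygyShortComplex i).f =
      ModuleCat.ofHom (Submodule.quotEquivOfEqBot _ hbot).toLinearMap ≫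
        ModuleCat.ofHom (F.diff i).mulVecLin := by
    refine ModuleCat.hom_ext (LinearMap.ext fun y => ?_)
    obtain ⟨w, rfl⟩ := Submodule.Quotient.mk_surjective _ y
    rfl
  rw [hf, ← Ext.mk₀_comp_mk₀, ← Ext.comp_assoc_of_third_deg_zero]
  refine Ext.comp_mulVecLin_eq_zero _ (fun j c => ?_) _
  rw [residue_annihilator]
  exact F.minimal i j c

/-- Passing from syzygy `i + 1` to syzygy `i` lowers the Ext degree by one: the class comes from the
connecting map because its image in `Ext^m(K, F_i)` is zero. At the last step, where `m = n`, this
is minimality; afterwards `m < n` and `Ext^m(K, S) = 0`. -/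
theorem exists_ext_syzygy_ne_zero {i : ℕ} (hi : i ≤ F.length) :
    ∃ m, m + F.length = n + i ∧
      ∃ x : Ext (residueModule K n) (ModuleCat.of _ (F.Syzygy i)) m, x ≠ 0 := by
  induction hi using Nat.decreasingInduction with
  | self => exact ⟨n, rfl, F.nontrivial_ext_syzygy_length⟩
  | of_succ i hi ih =>
    obtain ⟨m, hm, x, hx⟩ := ih
    have hz : x.comp (Ext.mk₀ (F.syzygyShortComplex i).f) (add_zero m) = 0 := by
      by_cases h : i + 1 = F.length
      · exact F.ext_comp_syzygyInclusion_length h x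
      · have := Ext.subsingleton_pi
          (subsingleton_ext_residue_self (K := K) (n := n) (i := m) (by omega)) (F.rank i)
        exact Subsingleton.elim _ _
    cases m with
    | zero =>
      have hmono := (F.syzygyShortComplex_shortExact i).mono_f
      refine absurd (Ext.postcomp_mk₀_injective_of_mono _ (F.syzygyShortComplex i).f ?_) hx
      rw [map_zero]
      exact hz
    | succ m =>
      obtain ⟨y, hy⟩ := Ext.covariant_sequence_exact₁ _ (F.syzygyShortComplex_shortExact i) x hz rfl
      refine ⟨m, by omega, y, fun h => hx ?_⟩
      rw [← hy, h, Ext.zero_comp]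

/-- The nonzero class that reaches `S/I`, the zeroth syzygy module, has degree `n - p`, so this
degree is at least `d`. -/
theorem length_add_le {d : ℕ} (h : ∀ i < d, Subsingleton (Ext (residueModule K n)
    (ModuleCat.of (MvPolynomial (Fin n) K) (MvPolynomial (Fin n) K ⧸ I)) i)) :
    F.length + d ≤ n := by
  obtain ⟨m, hm, x, hx⟩ := F.exists_ext_syzygy_ne_zero (Nat.zero_le _)
  by_contra! hlt
  have := h m (by omega)
  refine hx ?_
  have hid : 𝟙 (ModuleCat.of _ (F.Syzygy 0)) = ModuleCat.ofHom F.syzygyZeroEquiv.toLinearMap ≫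
      ModuleCat.ofHom F.syzygyZeroEquiv.symm.toLinearMap := by
    rw [← ModuleCat.ofHom_comp, LinearEquiv.symm_comp, ModuleCat.ofHom_id]
  rw [← Ext.comp_mk₀_id x, hid, ← Ext.mk₀_comp_mk₀, ← Ext.comp_assoc_of_third_deg_zero,
    Subsingleton.elim (x.comp (Ext.mk₀ (ModuleCat.ofHom F.syzygyZeroEquiv.toLinearMap)) _) 0,
    Ext.zero_comp]

/-- Dimension shifting down to `S/I`. The degree is written `m + 1` because the free modules in
between have no Ext into `S` only in positive degrees. -/
theorem exists_notMem_smul_ext_syzygy_eq_zero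
    (hI : I.IsHomogeneous (homogeneousSubmodule (Fin n) K)) (i m : ℕ)
    (h : ringKrullDim (MvPolynomial (Fin n) K ⧸ I) + (i + (m + 1) : ℕ) < n) :
    ∃ r ∉ idealOfVars (Fin n) K, ∀ x : Ext (ModuleCat.of (MvPolynomial (Fin n) K) (F.Syzygy i))
      (ModuleCat.of (MvPolynomial (Fin n) K) (MvPolynomial (Fin n) K)) (m + 1), r • x = 0 := by
  induction i generalizing m with
  | zero =>
    obtain ⟨r, hr, hr'⟩ := exists_notMem_smul_ext_eq_zero hI (m + 1) (by rwa [zero_add] at h)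
    refine ⟨r, hr, fun x => ?_⟩
    have hid : 𝟙 (ModuleCat.of _ (F.Syzygy 0)) = ModuleCat.ofHom F.syzygyZeroEquiv.toLinearMap ≫
        ModuleCat.ofHom F.syzygyZeroEquiv.symm.toLinearMap := by
      rw [← ModuleCat.ofHom_comp, LinearEquiv.symm_comp, ModuleCat.ofHom_id]
    rw [← Ext.mk₀_id_comp x, hid, ← Ext.mk₀_comp_mk₀_assoc, ← Ext.comp_smul, hr', Ext.comp_zero]
  | succ i ih =>
    obtain ⟨r, hr, hr'⟩ := ih (m + 1) (by
      rwa [show i + (m + 1 + 1) = i + 1 + (m + 1) by omega])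
    refine ⟨r, hr, fun x => ?_⟩
    obtain ⟨y, hy⟩ := Ext.contravariant_sequence_exact₁ (F.syzygyShortComplex_shortExact i) _
      (r • x) (add_comm 1 (m + 1)) (by
        rw [Ext.comp_smul]
        exact hr' _)
    have : Projective (F.syzygyShortComplex i).X₂ :=
      inferInstanceAs (Projective (ModuleCat.of _ (Fin (F.rank i) → MvPolynomial (Fin n) K)))
    rw [← hy, Ext.eq_zero_of_projective y, Ext.comp_zero]

/-- Below the codimension, no free summand of a syzygy module splits off: every row of the
differentials is nonzero. -/
theorem exists_diff_succ_ne_zero (hI : I.IsHomogeneous (homogeneousSubmodule (Fin n) K)) (i : ℕ)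
    (h : ringKrullDim (MvPolynomial (Fin n) K ⧸ I) + (i + 1 : ℕ) < n)
    (j : Fin (F.rank (i + 1))) : ∃ c, F.diff (i + 1) j c ≠ 0 := by
  by_contra! hrow
  obtain ⟨r, hr, hr'⟩ := F.exists_notMem_smul_ext_syzygy_eq_zero hI i 0 h
  -- A zero row lets the `j`-th coordinate descend to the syzygy module. As `r` kills `Ext^1` of the
  -- `i`-th syzygy module, `r • φ` extends to a map `ψ` on the `i`-th free module.
  let φ : F.Syzygy (i + 1) →ₗ[MvPolynomial (Fin n) K] MvPolynomial (Fin n) K :=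
    Submodule.liftQ _ (LinearMap.proj j) (by
      rintro _ ⟨w, rfl⟩
      simp [Matrix.mulVec, dotProduct, hrow])
  obtain ⟨y, hy⟩ := Ext.contravariant_sequence_exact₁ (F.syzygyShortComplex_shortExact i) _
    (r • Ext.mk₀ (ModuleCat.ofHom φ)) (add_comm 1 0) (by
      rw [Ext.comp_smul]
      exact hr' _)
  obtain ⟨ψ, rfl⟩ := (Ext.mk₀_bijective _ _).2 y
  rw [Ext.mk₀_comp_mk₀, ← Ext.mk₀_smul] at hy
  have he := (Ext.mk₀_bijective _ _).1 hy
  have hev := LinearMap.congr_fun (congrArg ModuleCat.Hom.hom he)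
    (Submodule.Quotient.mk (Pi.single j 1))
  have h₁ : (ModuleCat.Hom.hom (r • ModuleCat.ofHom φ))
      (Submodule.Quotient.mk (Pi.single j 1)) = r := by
    change r • (Pi.single j (1 : MvPolynomial (Fin n) K) : _ → _) j = r
    rw [Pi.single_eq_same, smul_eq_mul, mul_one]
  rw [h₁] at hev
  -- Evaluation at `e_j` gives `r = ψ (diff i · e_j)`, and minimality places the right side in the
  -- maximal ideal.
  refine hr ?_
  rw [← hev]
  change ψ.hom ((F.diff i).mulVecLin (Pi.single j 1)) ∈ _
  rw [← Finset.univ_sum_single ((F.diff i).mulVecLin (Pi.single j 1)), map_sum]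
  refine Ideal.sum_mem _ fun l _ => ?_
  have hs : (Pi.single l ((F.diff i).mulVecLin (Pi.single j 1) l) :
      Fin (F.rank i) → MvPolynomial (Fin n) K) = F.diff i l j • Pi.single l 1 := by
    rw [← Pi.single_smul, smul_eq_mul, mul_one]
    simp
  rw [hs, map_smul]
  exact Ideal.mul_mem_right _ _ (F.minimal i l j)

end MinimalGradedFreeResolution

theorem Finset.prod_Icc_one_eq_prod_range {A : Type*} [CommMonoid A] (f : ℕ → A) (s : ℕ) :
    ∏ i ∈ Finset.Icc 1 s, f i = ∏ k ∈ Finset.range s, f (k + 1) := by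
  rw [Finset.range_eq_Ico, Finset.prod_Ico_add' f 0 s 1]
  rfl

/-! ### Dimension and multiplicity. -/

section Multiplicity

variable {K : Type*} [Field K] {n : ℕ} {I : Ideal (MvPolynomial (Fin n) K)}

/-- Since `I` is proper and the dimension is at most `n`, the values `⊥` and `⊤`, where
`quotientDim` takes a default, do not occur. -/
theorem ringKrullDim_quotient_eq_quotientDim (hI : I ≤ idealOfVars (Fin n) K) :
    ringKrullDim (MvPolynomial (Fin n) K ⧸ I) = quotientDim I := by
  have hne : I ≠ ⊤ := fun h => isMaximal_idealOfVars.ne_top (top_le_iff.1 (h ▸ hI))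
  have := Ideal.Quotient.nontrivial_iff.2 hne
  have h0 := ringKrullDim_nonneg_of_nontrivial (R := MvPolynomial (Fin n) K ⧸ I)
  have hle : ringKrullDim (MvPolynomial (Fin n) K ⧸ I) ≤ n :=
    (ringKrullDim_quotient_le I).trans_eq ringKrullDim_mvPolynomial_fin
  unfold quotientDim
  generalize ringKrullDim (MvPolynomial (Fin n) K ⧸ I) = x at h0 hle
  induction x with
  | bot => simp at h0
  | coe x =>
    induction x with
    | top =>
      have h : (⊤ : ℕ∞) ≤ (n : ℕ∞) := by exact_mod_cast hle
      exact absurd h (not_le.2 (ENat.natCast_lt_top n))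
    | coe x => rfl

open scoped Polynomial in
theorem multiplicityQuot_eq_eval_one {Q : ℤ[X]}
    (hQ : (1 - PowerSeries.X) ^ quotientDim I * hilbertSeries I = (Q : PowerSeries ℤ)) :
    multiplicityQuot I = Q.eval 1 := by
  rw [multiplicityQuot, hQ, Polynomial.eval_eq_sum, Polynomial.sum,
    finsum_eq_sum_of_support_subset (s := Q.support)]
  · simp
  · intro k hk
    simpa using hk

end Multiplicity

/-! ### Quasi-pure shifts: signs of the terms and the equality cases. -/

namespace MinimalGradedFreeResolution

variable {K : Type*} [Field K] {n : ℕ} {I : Ideal (MvPolynomial (Fin n) K)}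
  (F : MinimalGradedFreeResolution I)

theorem evalFunctional_numerator (g : ℚ → ℚ) :
    evalFunctional g F.numerator =
      g 0 + ∑ i ∈ Finset.range F.length, ∑ j, (-1) ^ (i + 1) * g (F.shift (i + 1) j) := by
  have h (i : ℕ) : evalFunctional g ((-1) ^ i * ∑ j, Polynomial.X ^ F.shift i j) =
      ∑ j, (-1) ^ i * g (F.shift i j) := by
    rcases Nat.even_or_odd i with h' | h' <;>
    simp [h'.neg_one_pow, evalFunctional_X_pow]
  rw [numerator, map_sum, Finset.sum_range_succ', add_comm]
  simp_rw [h]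
  simp [F.shift_zero, F.rank_zero]

open scoped Polynomial in
theorem numerator_eq_one_sub_X_pow_mul {d s : ℕ} (hn : d + s = n) {Q : ℤ[X]}
    (hQ : (1 - PowerSeries.X) ^ d * hilbertSeries I = (Q : PowerSeries ℤ)) :
    F.numerator = (1 - Polynomial.X) ^ s * Q := by
  apply Polynomial.coe_injective
  have hpow : (1 - PowerSeries.X : PowerSeries ℤ) ^ n =
      (1 - PowerSeries.X) ^ d * (1 - PowerSeries.X) ^ s := by rw [← pow_add, hn]
  rw [← F.one_sub_X_pow_mul_hilbertSeries, hpow, mul_right_comm, hQ]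
  simp [mul_comm]

theorem minShift_le_maxShift {i : ℕ} (hi : i ≤ F.length) : F.minShift i ≤ F.maxShift i := by
  obtain ⟨j, hj⟩ := F.exists_shift_eq_minShift hi
  exact hj ▸ F.le_maxShift i j

variable {F}

theorem IsQuasiPure.maxShift_le_minShift (hF : F.IsQuasiPure) {i k : ℕ} (hik : i < k)
    (hk : k ≤ F.length) : F.maxShift i ≤ F.minShift k := by
  induction k, hik using Nat.le_induction with
  | base => exact hF i hk
  | succ k hik ih =>
    exact (ih (by omega)).trans ((F.minShift_le_maxShift (by omega)).trans (hF k hk))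

theorem IsQuasiPure.minShift_mono (hF : F.IsQuasiPure) {i k : ℕ} (hik : i ≤ k)
    (hk : k ≤ F.length) : F.minShift i ≤ F.minShift k := by
  rcases hik.eq_or_lt with rfl | h
  · rfl
  · exact (F.minShift_le_maxShift (by omega)).trans (hF.maxShift_le_minShift h hk)

theorem IsQuasiPure.maxShift_mono (hF : F.IsQuasiPure) {i k : ℕ} (hik : i ≤ k)
    (hk : k ≤ F.length) : F.maxShift i ≤ F.maxShift k := by
  rcases hik.eq_or_lt with rfl | h
  · rfl
  · exact (hF.maxShift_le_minShift h hk).trans (F.minShift_le_maxShift hk)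

/-- A shift at step `i + 1` is at least `m₁, …, mᵢ₊₁` and at most every later `mₖ`, which gives `i +
1` nonpositive factors. -/
theorem IsQuasiPure.lower_term_nonneg (hF : F.IsQuasiPure) {i : ℕ} (hi : i < F.length)
    (j : Fin (F.rank (i + 1))) : (0 : ℚ) ≤ (-1) ^ (i + 1) *
      ∏ k ∈ Finset.range F.length, ((F.minShift (k + 1) : ℚ) - F.shift (i + 1) j) := by
  refine neg_one_pow_mul_prod_sub_nonneg hi _ _ (fun k hk => ?_) fun k hk hk' => ?_
  · exact_mod_cast (hF.minShift_mono (by omega) hi).trans (F.minShift_le _ j)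
  · exact_mod_cast (F.le_maxShift _ j).trans (hF.maxShift_le_minShift (by omega) hk')

/-- Here `Mᵢ₊₁` lies above the shift, so only the first `i` factors are nonpositive and one sign
`-1` is left over. -/
theorem IsQuasiPure.upper_term_nonpos (hF : F.IsQuasiPure) {i : ℕ} (hi : i < F.length)
    (j : Fin (F.rank (i + 1))) : (-1) ^ (i + 1) *
      ∏ k ∈ Finset.range F.length, ((F.maxShift (k + 1) : ℚ) - F.shift (i + 1) j) ≤ 0 := by
  have := neg_one_pow_mul_prod_sub_nonneg hi.le (fun k => (F.maxShift (k + 1) : ℚ))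
    (F.shift (i + 1) j) (fun k hk => ?_) fun k hk hk' => ?_
  · rw [pow_succ]
    linarith
  · exact_mod_cast (hF.maxShift_le_minShift (by omega) hi).trans (F.minShift_le _ j)
  · exact_mod_cast (F.le_maxShift _ j).trans (hF.maxShift_mono (by omega) hk')

theorem prod_minShift_pos (F : MinimalGradedFreeResolution I) :
    (0 : ℚ) < ∏ k ∈ Finset.range F.length, (F.minShift (k + 1) : ℚ) := by
  refine Finset.prod_pos fun k hk => ?_
  obtain ⟨j, hj⟩ := F.exists_shift_eq_minShift (i := k + 1) (Finset.mem_range.1 hk)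
  have := F.minShift_lt_shift_succ k j
  exact_mod_cast (by omega : 0 < F.minShift (k + 1))

open scoped Polynomial in
-- With only `p < s` factors the functional kills `(1 - t) ^ s * Q`. On the numerator it equals `∏
-- mₖ > 0` plus nonnegative terms.
theorem IsQuasiPure.codim_le_length (hF : F.IsQuasiPure) {s : ℕ} {Q : ℤ[X]}
    (hQ : F.numerator = (1 - Polynomial.X) ^ s * Q) : s ≤ F.length := by
  by_contra! hlt
  have h := evalFunctional_prod_of_lt hlt (fun k => (F.minShift (k + 1) : ℚ)) Q
  rw [← hQ, evalFunctional_numerator] at h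
  have hpos := F.prod_minShift_pos
  have hnn := Finset.sum_nonneg fun i hi => Finset.sum_nonneg fun j (_ : j ∈ Finset.univ) =>
    hF.lower_term_nonneg (Finset.mem_range.1 hi) j
  simp only [sub_zero] at h
  linarith

theorem IsPure.of_shift_eq (F : MinimalGradedFreeResolution I) (a : ℕ → ℕ)
    (h : ∀ i < F.length, ∀ j, F.shift (i + 1) j = a (i + 1)) : F.IsPure := by
  intro i j k
  rcases Nat.lt_or_ge F.length i with hi | hi
  · exact absurd j.pos (by rw [F.rank_of_length_lt i hi]; exact lt_irrefl 0)
  · cases i with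
    | zero => rw [F.shift_zero, F.shift_zero]
    | succ i => rw [h i hi, h i hi]

/-- In the case of equality in the upper bound the shifts at each step agree. -/
theorem IsQuasiPure.isPure_of_exists_maxShift (hF : F.IsQuasiPure)
    (h : ∀ i < F.length, ∀ j : Fin (F.rank (i + 1)),
      ∃ k < F.length, F.maxShift (k + 1) = F.shift (i + 1) j) : F.IsPure := by
  refine IsPure.of_shift_eq F F.maxShift fun i hi => ?_
  -- Upward induction: once step `i` is pure, a nonzero column forces the shift above `Mᵢ`. Being
  -- one of the `Mₖ`, it is then at least `Mᵢ₊₁`.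
  have key : ∀ i ≤ F.length, ∀ j, F.shift i j = F.maxShift i := by
    intro i
    induction i with
    | zero =>
      intro hi j
      obtain ⟨j', hj'⟩ := F.exists_shift_eq_maxShift hi
      rw [← hj', F.shift_zero, F.shift_zero]
    | succ i ih =>
      intro hi j
      obtain ⟨j', hj'⟩ := F.exists_shift_eq_minShift (i := i) (by omega)
      have hlt := F.minShift_lt_shift_succ i j
      rw [← hj', ih (by omega)] at hlt
      obtain ⟨k, hk, hkj⟩ := h i hi j
      have hik : i < k + 1 := by
        by_contra! hle
        have := hF.maxShift_mono hle (by omega)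
        omega
      have h₁ := hF.maxShift_mono (i := i + 1) (k := k + 1) (by omega) hk
      have h₂ := F.le_maxShift (i + 1) j
      omega
  exact key (i + 1) hi

/-- In the case of equality in the lower bound the shifts at each step agree. -/
theorem IsQuasiPure.isPure_of_exists_minShift (hF : F.IsQuasiPure)
    (hrow : ∀ i, i + 1 < F.length → ∀ j : Fin (F.rank (i + 1)), ∃ c, F.diff (i + 1) j c ≠ 0)
    (h : ∀ i < F.length, ∀ j : Fin (F.rank (i + 1)),
      ∃ k < F.length, F.minShift (k + 1) = F.shift (i + 1) j) : F.IsPure := by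
  refine IsPure.of_shift_eq F F.minShift fun i hi => ?_
  -- Downward induction, with `t` the distance to the last step: a nonzero row forces the shift
  -- below `mᵢ₊₂`. Being one of the `mₖ`, it is then at most `mᵢ₊₁`.
  have key : ∀ t i, i + 1 + t = F.length → ∀ j, F.shift (i + 1) j = F.minShift (i + 1) := by
    intro t
    induction t with
    | zero =>
      intro i hi j
      obtain ⟨k, hk, hkj⟩ := h i (by omega) j
      have h₁ := hF.minShift_mono (i := k + 1) (k := i + 1) (by omega) (by omega)
      have h₂ := F.minShift_le (i + 1) j
      omega
    | succ t ih =>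
      intro i hi j
      obtain ⟨c, hc⟩ := hrow i (by omega) j
      have hlt := F.shift_lt_shift_of_diff_ne_zero hc
      rw [ih (i + 1) (by omega)] at hlt
      obtain ⟨k, hk, hkj⟩ := h i (by omega) j
      have hik : k + 1 ≤ i + 1 := by
        by_contra! hle
        have := hF.minShift_mono (i := i + 1 + 1) (k := k + 1) (by omega) hk
        omega
      have h₁ := hF.minShift_mono hik (by omega)
      have h₂ := F.minShift_le (i + 1) j
      omega
  exact key (F.length - (i + 1)) i (by omega)

theorem exists_eq_of_term_eq_zero {s : ℕ} {i : ℕ} {a : ℕ → ℕ} {x : ℕ}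
    (h : (-1 : ℚ) ^ i * ∏ k ∈ Finset.range s, ((a (k + 1) : ℚ) - x) = 0) :
    ∃ k < s, a (k + 1) = x := by
  obtain ⟨k, hk, hk'⟩ := Finset.prod_eq_zero_iff.1 ((mul_eq_zero.1 h).resolve_left (by simp))
  exact ⟨k, Finset.mem_range.1 hk, by exact_mod_cast sub_eq_zero.1 hk'⟩

end MinimalGradedFreeResolution

end

/-! ### The multiplicity bounds. -/

theorem theorem3p4 {K : Type*} [Field K] {n : ℕ} (I : Ideal (MvPolynomial (Fin n) K))
    (hI : IsProperGradedIdeal I) (s : ℕ) (hs : HasCodimension I s)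
    (hCM : IsCohenMacaulayIdeal I)
    (F : MinimalGradedFreeResolution I) (hF : F.IsQuasiPure) :
    F.length = s ∧
    F.lowerBound s ≤ (multiplicityQuot I : ℚ) ∧
    (multiplicityQuot I : ℚ) ≤ F.upperBound s ∧
    ((multiplicityQuot I : ℚ) = F.lowerBound s ∨ (multiplicityQuot I : ℚ) = F.upperBound s →
      F.IsPure) := by
  obtain ⟨hhom, hle⟩ := hI
  have hdim := ringKrullDim_quotient_eq_quotientDim hle
  have hn : quotientDim I + s = n := by
    rw [HasCodimension, hdim, ringKrullDim_mvPolynomial_fin] at hs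
    exact_mod_cast hs
  obtain ⟨Q, hQ⟩ := exists_polynomial_hilbertSeries hhom (quotientDim I) hdim.le
  have hnum := F.numerator_eq_one_sub_X_pow_mul hn hQ
  have hlen : F.length = s := by
    refine le_antisymm ?_ (hF.codim_le_length hnum)
    obtain ⟨rs, hreg, hmem, hrs⟩ := hCM
    rw [hdim] at hrs
    have hrs' : rs.length = quotientDim I := by exact_mod_cast hrs
    have := F.length_add_le fun i (hi : i < rs.length) =>
      subsingleton_ext_residue_quotient hle hreg hmem hi
    omega
  have hfact : (0 : ℚ) < s.factorial := by exact_mod_cast s.factorial_pos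
  -- Evaluated on the numerator, these express `s! * e` as the product of the extremal shifts, the
  -- value at `0`, plus terms of constant sign.
  have hlow := evalFunctional_prod s (fun k => (F.minShift (k + 1) : ℚ)) Q
  have hupp := evalFunctional_prod s (fun k => (F.maxShift (k + 1) : ℚ)) Q
  rw [← hnum, F.evalFunctional_numerator, ← multiplicityQuot_eq_eval_one hQ] at hlow hupp
  simp only [sub_zero] at hlow hupp
  rw [MinimalGradedFreeResolution.lowerBound, MinimalGradedFreeResolution.upperBound,
    Finset.prod_Icc_one_eq_prod_range, Finset.prod_Icc_one_eq_prod_range]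
  subst hlen
  have hlow_nonneg : ∀ i ∈ Finset.range F.length,
      ∀ j ∈ (Finset.univ : Finset (Fin (F.rank (i + 1)))),
      (0 : ℚ) ≤ _ := fun i hi j _ => hF.lower_term_nonneg (Finset.mem_range.1 hi) j
  have hupp_nonpos : ∀ i ∈ Finset.range F.length,
      ∀ j ∈ (Finset.univ : Finset (Fin (F.rank (i + 1)))),
      _ ≤ (0 : ℚ) := fun i hi j _ => hF.upper_term_nonpos (Finset.mem_range.1 hi) j
  have hlow_sum := Finset.sum_nonneg fun i hi => Finset.sum_nonneg (hlow_nonneg i hi)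
  have hupp_sum := Finset.sum_nonpos fun i hi => Finset.sum_nonpos (hupp_nonpos i hi)
  refine ⟨rfl, ?_, ?_, ?_⟩
  · rw [div_le_iff₀ hfact]
    linarith
  · rw [le_div_iff₀ hfact]
    linarith
  · rintro (h | h)
    · rw [eq_div_iff hfact.ne'] at h
      -- Equality makes a sum of nonnegative terms zero, so each term has a vanishing factor.
      have hz := (Finset.sum_eq_zero_iff_of_nonneg fun i hi =>
        Finset.sum_nonneg (hlow_nonneg i hi)).1 (by linarith)
      refine hF.isPure_of_exists_minShift (fun i hi j => ?_) fun i hi j => ?_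
      · refine F.exists_diff_succ_ne_zero hhom i ?_ j
        rw [hdim]
        exact_mod_cast (by omega : quotientDim I + (i + 1) < n)
      · exact MinimalGradedFreeResolution.exists_eq_of_term_eq_zero
          ((Finset.sum_eq_zero_iff_of_nonneg (hlow_nonneg i (Finset.mem_range.2 hi))).1
            (hz i (Finset.mem_range.2 hi)) j (Finset.mem_univ j))
    · rw [eq_div_iff hfact.ne'] at h
      have hz := (Finset.sum_eq_zero_iff_of_nonpos fun i hi =>
        Finset.sum_nonpos (hupp_nonpos i hi)).1 (by linarith)
      refine hF.isPure_of_exists_maxShift fun i hi j => ?_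
      exact MinimalGradedFreeResolution.exists_eq_of_term_eq_zero
        ((Finset.sum_eq_zero_iff_of_nonpos (hupp_nonpos i (Finset.mem_range.2 hi))).1
          (hz i (Finset.mem_range.2 hi)) j (Finset.mem_univ j))
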